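/- Let $\Gamma=\{z\in\mathbb C:|z|=1\}$, let $|Q|$ denote the linear (arc length) measure of $Q\subset\Gamma$, and for $S\subset\Gamma$ and an integer $m\ge 1$ let $\mathfrak P_m(S)$ be the set of polynomials $P(z)=\prod_{j=1}^m(z-z_j)$ with $z_1,\dots,z_m\in S$ (not necessarily distinct). For a nonempty compact set $Q\subset\Gamma$ put $\|P\|_{C(Q)}=\max_{z\in Q}|P(z)|$ and $$E_m(Q)=\inf\{\|P\|_{C(Q)}:\ P\in\mathfrak P_m(\Gamma)\}.$$ For $0<\alpha<\pi$ put $E_m(2\alpha)=\inf\{E_m(Q):\ Q\subset\Gamma \text{ compact},\ |Q|=2\alpha\}$. For a segment $I=[a,b]$ with $b-a=2\alpha$, let $\Gamma(I)=\{e^{it}:t\in I\}$ and $\varepsilon_m(I)=\min\{\|P\|_{C(\Gamma(I))}:\ P\in\mathfrak P_m(\Gamma(I))\}$; this minimum exists and depends only on the length of $I$, and is denoted by $\varepsilon_m(2\alpha)$. Theorem. Let $m\ge1$ and $0<\alpha<\pi$. For every compact set $Q\subset\Gamma$ with $|Q|=2\alpha$, $$E_m(Q)\ge 2\sin^m\frac{\alpha}{2},$$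 and equality holds if and only if $Q$ is a closed arc of length $2\alpha$. Consequently, $$E_m(2\alpha)=\varepsilon_m(2\alpha)=2\sin^m\frac{\alpha}{2}.$$ -/

import Mathlib

noncomputable section

/-- The unit circle `Γ` of the complex plane. -/
def unitCircle : Set ℂ := Metric.sphere (0 : ℂ) 1

/-- The closed arc `Γ([a, b]) = {e^{it} : a ≤ t ≤ b}` of the unit circle. -/
def circleArc (a b : ℝ) : Set ℂ :=
  (fun t : ℝ => Complex.exp ((t : ℂ) * Complex.I)) '' Set.Icc a b

/-- The linear (arc length) measure of `Q ∩ Γ`: the Lebesgue measure of the set of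
`t ∈ [0, 2π)` with `e^{it} ∈ Q`. -/
def circleMeasure (Q : Set ℂ) : ENNReal :=
  MeasureTheory.volume
    {t : ℝ | t ∈ Set.Ico 0 (2 * Real.pi) ∧ Complex.exp ((t : ℂ) * Complex.I) ∈ Q}

/-- The polynomials `∏ (z - z_j)` of degree `m` with leading coefficient one, all of whose `m`
zeros `z_1, …, z_m` (not necessarily distinct) lie in `S`. -/
def polysWithZerosOn (m : ℕ) (S : Set ℂ) : Set (Polynomial ℂ) :=
  {P | ∃ z : Fin m → ℂ, (∀ j, z j ∈ S) ∧ P = ∏ j, (Polynomial.X - Polynomial.C (z j))}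

/-- The uniform norm of `P` on `Q` (used for nonempty compact sets `Q`). -/
def polySupNorm (Q : Set ℂ) (P : Polynomial ℂ) : ℝ :=
  sSup ((fun z : ℂ => ‖P.eval z‖) '' Q)

/-- `E_m(Q)`: the best uniform deviation from zero on `Q` of polynomials of degree `m`, with
leading coefficient one and all zeros on the unit circle. -/
def leastDeviation (m : ℕ) (Q : Set ℂ) : ℝ :=
  sInf (polySupNorm Q '' polysWithZerosOn m unitCircle)

/-- The compact subsets of the unit circle of linear measure `l` (used for `l ≥ 0`). -/
def compactsOfMeasure (l : ℝ) : Set (Set ℂ) :=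
  {Q | IsCompact Q ∧ Q ⊆ unitCircle ∧ circleMeasure Q = ENNReal.ofReal l}

/-- `E_m(l)`: the infimum of `E_m(Q)` over the compact subsets of the circle of measure `l`. -/
def leastDeviationOfMeasure (m : ℕ) (l : ℝ) : ℝ :=
  sInf (leastDeviation m '' compactsOfMeasure l)

/-- `ε_m([a, b])`: the least uniform norm on the arc `Γ([a, b])` of polynomials of degree `m`,
with leading coefficient one and all zeros on that same arc. -/
def arcDeviation (m : ℕ) (a b : ℝ) : ℝ :=
  sInf (polySupNorm (circleArc a b) '' polysWithZerosOn m (circleArc a b))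

end

/-! Let `P` be monic with all zeros on the circle and `|P| ≤ M` on `Q`. On the circle `P² = P(0) z^m
|P|²`, so both roots of `X² - 2PX + P(0)M²z^m` have modulus `M` wherever `|P| ≤ M`. The larger root
modulus `E` is subharmonic in the plane, equals `M` on `Q` and `2` at the origin, and is `O(|z|^m)`
at infinity.

The growth is absorbed by a function `B`, holomorphic off `Q`, with `|B| ≤ 1` and `B(∞) = 0`. Let
`H` be the Herglotz integral of the indicator of `Q`: its real part is the harmonic measure of `Q`
inside the disc and changes sign under reflection. Hence `exp(iπH/2)` takes values in the right
half-plane, with value `e^{iα/2}` at `0` and `e^{-iα/2}` at infinity. A Möbius map sending the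
latter to `0` gives `B`, and `|B(0)| = sin(α/2)` whatever the shape of `Q`. The maximum principle
yields `E|B|^m ≤ M` off `Q`, and the origin gives the bound (`two_mul_sin_pow_le`).

If equality holds, the maximum is attained at `0`, so `E|B|^m = M` near every point of the circle
off `Q`. There `E|B|^m` is locally the modulus of a holomorphic function, which must be constant;
its phase shows that `t + 2 arg B(e^{it})` is constant on each gap of `Q`. At the ends of a gap `arg
B` tends to `0` or `π - α`, so the gap has length `2(π - α)` (`gap_length`) and exhausts the
complement: `Q` is an arc.

For an arc, the Chebyshev polynomial in `sin((t - c)/2) / sin(α/2)` supplies a polynomial attaining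
the bound, with zeros on the arc (`norm_zerosProd_extremalZero_le`). -/

open Filter Topology MeasureTheory

/-! ### The larger root modulus, free of any branch of the square root. -/

/-- The larger of the two numbers `‖p + √y‖` and `‖p - √y‖`. -/
noncomputable def rootEnvelope (p y : ℂ) : ℝ :=
  √(‖p‖ ^ 2 + ‖y‖ + √((‖p‖ ^ 2 + ‖y‖) ^ 2 - ‖p ^ 2 - y‖ ^ 2))

theorem continuous_rootEnvelope : Continuous fun q : ℂ × ℂ => rootEnvelope q.1 q.2 := by
  unfold rootEnvelope
  fun_prop

theorem rootEnvelope_nonneg (p y : ℂ) : 0 ≤ rootEnvelope p y := Real.sqrt_nonneg _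

/-- The parallelogram law gives the sum of `‖p + g‖²` and `‖p - g‖²`, and `‖p² - g²‖` is the product
of the norms; the definition solves the resulting quadratic for the larger square. Being written in
`y = g²`, it is continuous also at `y = 0`. -/
theorem rootEnvelope_sq_eq_max (p g : ℂ) :
    rootEnvelope p (g ^ 2) = max ‖p + g‖ ‖p - g‖ := by
  have h1 : ‖p + g‖ ^ 2 + ‖p - g‖ ^ 2 = 2 * (‖p‖ ^ 2 + ‖g ^ 2‖) := by
    have := parallelogram_law_with_norm ℝ p g
    rw [norm_pow]; nlinarith
  have h2 : ‖p ^ 2 - g ^ 2‖ = ‖p + g‖ * ‖p - g‖ := by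
    rw [← norm_mul]; congr 1; ring
  have h3 : (‖p‖ ^ 2 + ‖g ^ 2‖) ^ 2 - ‖p ^ 2 - g ^ 2‖ ^ 2
      = ((‖p + g‖ ^ 2 - ‖p - g‖ ^ 2) / 2) ^ 2 := by
    rw [h2]
    have : ‖p‖ ^ 2 + ‖g ^ 2‖ = (‖p + g‖ ^ 2 + ‖p - g‖ ^ 2) / 2 := by linarith
    rw [this]; ring
  unfold rootEnvelope
  rw [h3, Real.sqrt_sq_eq_abs]
  have hp := norm_nonneg (p + g)
  have hm := norm_nonneg (p - g)
  rcases le_total ‖p + g‖ ‖p - g‖ with h | h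
  · rw [max_eq_right h, abs_of_nonpos (by nlinarith)]
    rw [show ‖p‖ ^ 2 + ‖g ^ 2‖ + -((‖p + g‖ ^ 2 - ‖p - g‖ ^ 2) / 2) = ‖p - g‖ ^ 2 by linarith]
    exact Real.sqrt_sq hm
  · rw [max_eq_left h, abs_of_nonneg (by nlinarith)]
    rw [show ‖p‖ ^ 2 + ‖g ^ 2‖ + (‖p + g‖ ^ 2 - ‖p - g‖ ^ 2) / 2 = ‖p + g‖ ^ 2 by linarith]
    exact Real.sqrt_sq hp

theorem rootEnvelope_zero (p : ℂ) : rootEnvelope p 0 = ‖p‖ := by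
  have := rootEnvelope_sq_eq_max p 0
  simpa using this

theorem norm_le_rootEnvelope (p y : ℂ) : ‖p‖ ≤ rootEnvelope p y := by
  unfold rootEnvelope
  apply Real.le_sqrt_of_sq_le
  have := norm_nonneg y
  have := Real.sqrt_nonneg ((‖p‖ ^ 2 + ‖y‖) ^ 2 - ‖p ^ 2 - y‖ ^ 2)
  linarith

theorem rootEnvelope_le (p y : ℂ) : rootEnvelope p y ≤ ‖p‖ + √‖y‖ := by
  obtain ⟨g, rfl⟩ := IsAlgClosed.exists_pow_nat_eq y two_pos
  rw [rootEnvelope_sq_eq_max, norm_pow, Real.sqrt_sq (norm_nonneg _)]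
  exact max_le (norm_add_le _ _) (norm_sub_le _ _)

/-! ### Maximum principles through holomorphic minorants. -/

/-- A function has a holomorphic minorant touching it at `z₀`; this is the form of
subharmonicity used for the maximum principle. -/
def HasHolomorphicSupportAt (f : ℂ → ℝ) (z₀ : ℂ) : Prop :=
  ∃ h : ℂ → ℂ, (∀ᶠ z in 𝓝 z₀, DifferentiableAt ℂ h z) ∧ (∀ᶠ z in 𝓝 z₀, ‖h z‖ ≤ f z) ∧
    ‖h z₀‖ = f z₀

theorem HasHolomorphicSupportAt.eventually_eq {f : ℂ → ℝ} {z₀ : ℂ}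
    (hf : HasHolomorphicSupportAt f z₀) (hmax : ∀ᶠ z in 𝓝 z₀, f z ≤ f z₀) :
    ∀ᶠ z in 𝓝 z₀, f z = f z₀ := by
  obtain ⟨h, hd, hle, heq⟩ := hf
  have : IsLocalMax (norm ∘ h) z₀ := by
    filter_upwards [hle, hmax] with z h1 h2
    simp only [Function.comp]
    rw [heq]; exact h1.trans h2
  have := Complex.eventually_eq_of_isLocalMax_norm hd this
  filter_upwards [this, hle, hmax] with z h1 h2 h3
  rw [h1, heq] at h2
  exact le_antisymm h3 h2

theorem HasHolomorphicSupportAt.pow {f : ℂ → ℝ} {z₀ : ℂ}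
    (hf : HasHolomorphicSupportAt f z₀) (k : ℕ) :
    HasHolomorphicSupportAt (fun z => f z ^ k) z₀ := by
  obtain ⟨h, hd, hle, heq⟩ := hf
  refine ⟨fun z => h z ^ k, hd.mono fun z hz => hz.pow k, ?_, by simp [heq]⟩
  filter_upwards [hle] with z hz
  rw [norm_pow]
  gcongr

theorem HasHolomorphicSupportAt.mul_norm {f : ℂ → ℝ} {z₀ : ℂ} {b : ℂ → ℂ}
    (hf : HasHolomorphicSupportAt f z₀) (hb : ∀ᶠ z in 𝓝 z₀, DifferentiableAt ℂ b z) :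
    HasHolomorphicSupportAt (fun z => f z * ‖b z‖) z₀ := by
  obtain ⟨h, hd, hle, heq⟩ := hf
  refine ⟨fun z => h z * b z, ?_, ?_, by simp [heq]⟩
  · filter_upwards [hd, hb] with z h1 h2 using h1.mul h2
  · filter_upwards [hle] with z hz
    rw [norm_mul]
    gcongr

/-- Dividing by `Y z₀` moves the value at `z₀` to `1`, inside the domain of the principal branch.
The identity `g² = Y` is global; only differentiability is local. -/
theorem exists_holomorphic_sqrt {Y : ℂ → ℂ} (hY : Differentiable ℂ Y) {z₀ : ℂ} (h0 : Y z₀ ≠ 0) :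
    ∃ g : ℂ → ℂ, (∀ᶠ z in 𝓝 z₀, DifferentiableAt ℂ g z) ∧ ∀ z, g z ^ 2 = Y z := by
  obtain ⟨c, hc⟩ := IsAlgClosed.exists_pow_nat_eq (Y z₀) two_pos
  refine ⟨fun z => c * (Y z / Y z₀) ^ (1 / 2 : ℂ), ?_, ?_⟩
  · have hcont : ContinuousAt (fun z => Y z / Y z₀) z₀ := (hY z₀).continuousAt.div_const _
    have : ∀ᶠ z in 𝓝 z₀, Y z / Y z₀ ∈ Complex.slitPlane := by
      apply hcont.eventually_mem
      apply Complex.isOpen_slitPlane.mem_nhds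
      simp [div_self h0]
    filter_upwards [this] with z hz
    exact (((hY z).div_const _).cpow_const hz).const_mul _
  · intro z
    rw [mul_pow, hc, ← Complex.cpow_nat_mul]
    norm_num
    field_simp

/-- At a zero of `Y` the two roots merge and `P` itself is the minorant; elsewhere a local root `g`
exists and one of `P ± g` serves. -/
theorem hasHolomorphicSupportAt_rootEnvelope {P Y : ℂ → ℂ} (hP : Differentiable ℂ P)
    (hY : Differentiable ℂ Y) (z₀ : ℂ) :
    HasHolomorphicSupportAt (fun z => rootEnvelope (P z) (Y z)) z₀ := by
  by_cases h0 : Y z₀ = 0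
  · exact ⟨P, Eventually.of_forall fun z => hP z,
      Eventually.of_forall fun z => norm_le_rootEnvelope _ _, by simp [h0, rootEnvelope_zero]⟩
  · obtain ⟨g, hg, hgY⟩ := exists_holomorphic_sqrt hY h0
    have key : ∀ z, rootEnvelope (P z) (Y z) = max ‖P z + g z‖ ‖P z - g z‖ := fun z => by
      rw [← hgY, rootEnvelope_sq_eq_max]
    rcases le_total ‖P z₀ + g z₀‖ ‖P z₀ - g z₀‖ with h | h
    · refine ⟨fun z => P z - g z, hg.mono fun z hz => (hP z).sub hz,
        Eventually.of_forall fun z => ?_, ?_⟩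
      · simp only [key]; exact le_max_right _ _
      · simp only [key]; rw [max_eq_right h]
    · refine ⟨fun z => P z + g z, hg.mono fun z hz => (hP z).add hz,
        Eventually.of_forall fun z => ?_, ?_⟩
      · simp only [key]; exact le_max_left _ _
      · simp only [key]; rw [max_eq_left h]

/-- Maximum principle on the complement of a closed set. -/
theorem le_of_hasHolomorphicSupport {Q : Set ℂ} (hQ : IsClosed Q) {f F : ℂ → ℝ} {C : ℝ}
    (hC : 0 ≤ C) (hf : ContinuousOn f Qᶜ) (hs : ∀ z ∈ Qᶜ, HasHolomorphicSupportAt f z)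
    (hF : Continuous F) (hfF : ∀ z ∈ Qᶜ, f z ≤ F z) (hFQ : ∀ z ∈ Q, F z ≤ C)
    (hinf : Tendsto f (cocompact ℂ) (𝓝 0)) {z : ℂ} (hz : z ∈ Qᶜ) : f z ≤ C := by
  by_contra! hlt
  set c := f z with hc
  set K : Set ℂ := {w | w ∈ Qᶜ ∧ c ≤ f w} with hK
  -- `f` need not extend continuously to `Q`; the majorant `F ≤ C < c` on `Q` is what keeps limits
  -- of points of `K` off `Q`.
  have hKclosed : IsClosed K := by
    rw [← isSeqClosed_iff_isClosed]
    intro x w hx hw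
    have hFw : c ≤ F w :=
      ge_of_tendsto (hF.continuousAt.tendsto.comp hw)
        (Eventually.of_forall fun n => (hx n).2.trans (hfF _ (hx n).1))
    have hwQ : w ∈ Qᶜ := fun h => absurd (hFQ w h) (by linarith)
    refine ⟨hwQ, ?_⟩
    exact ge_of_tendsto ((hf.continuousAt (hQ.isOpen_compl.mem_nhds hwQ)).tendsto.comp hw)
        (Eventually.of_forall fun n => (hx n).2)
  have hKcomp : IsCompact K := by
    have h1 : ∀ᶠ w in cocompact ℂ, f w < c := hinf.eventually_lt_const (by linarith)
    obtain ⟨T, hT, hTs⟩ := mem_cocompact.1 h1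
    refine hT.of_isClosed_subset hKclosed fun w hw => ?_
    by_contra hwT
    have := hTs hwT
    exact absurd hw.2 (not_le.2 this)
  obtain ⟨z₁, hz₁, hmax⟩ := hKcomp.exists_isMaxOn ⟨z, hz, le_rfl⟩
    (hf.mono fun w hw => hw.1)
  have hmax' : ∀ w ∈ Qᶜ, f w ≤ f z₁ := by
    intro w hw
    by_cases h : c ≤ f w
    · exact hmax ⟨hw, h⟩
    · exact (not_le.1 h).le.trans hz₁.2
  set S : Set ℂ := {w | w ∈ Qᶜ ∧ f w = f z₁} with hS
  have hSK : S ⊆ K := fun w hw => ⟨hw.1, hw.2 ▸ hz₁.2⟩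
  have hSopen : IsOpen S := by
    rw [isOpen_iff_mem_nhds]
    intro w hw
    have hU := hQ.isOpen_compl.mem_nhds hw.1
    have := (hs w hw.1).eventually_eq (by
      filter_upwards [hU] with v hv
      rw [hw.2]; exact hmax' v hv)
    filter_upwards [this, hU] with v h1 h2 using ⟨h2, h1.trans hw.2⟩
  have hSclosed : IsClosed S := by
    have hSeq : S = K ∩ f ⁻¹' {f z₁} := by
      ext w; exact ⟨fun h => ⟨hSK h, h.2⟩, fun h => ⟨h.1.1, h.2⟩⟩
    have h2 : ContinuousOn f K := hf.mono fun w hw => hw.1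
    have := h2.preimage_isClosed_of_isClosed hKclosed (isClosed_singleton (x := f z₁))
    rw [hSeq]
    exact this
  -- The set of maxima is clopen in the whole plane, so connectedness of the complement of `Q` is
  -- not needed.
  have hSuniv : S = Set.univ := IsClopen.eq_univ ⟨hSclosed, hSopen⟩ ⟨z₁, hz₁.1, rfl⟩
  have : IsCompact (Set.univ : Set ℂ) := hKcomp.of_isClosed_subset isClosed_univ (hSuniv ▸ hSK)
  exact noncompact_univ ℂ this

/-- Strong maximum principle along a preconnected subset. -/
theorem eq_of_hasHolomorphicSupport {Q : Set ℂ} (hQ : IsClosed Q) {f : ℂ → ℝ} {C : ℝ}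
    (hf : ContinuousOn f Qᶜ) (hs : ∀ z ∈ Qᶜ, HasHolomorphicSupportAt f z)
    (hfC : ∀ z ∈ Qᶜ, f z ≤ C) {A : Set ℂ} (hA : IsPreconnected A) (hAQ : A ⊆ Qᶜ) {z₀ : ℂ}
    (h0 : z₀ ∈ A) (hf0 : f z₀ = C) : ∀ z ∈ A, ∀ᶠ w in 𝓝 z, f w = C := by
  have hnear : ∀ z ∈ Qᶜ, f z = C → ∀ᶠ w in 𝓝 z, f w = C := by
    intro z hz hzC
    have := (hs z hz).eventually_eq (by
      filter_upwards [hQ.isOpen_compl.mem_nhds hz] with v hv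
      rw [hzC]; exact hfC v hv)
    rwa [hzC] at this
  set S : Set ℂ := {w | w ∈ Qᶜ ∧ f w = C}
  have hSopen : IsOpen S := by
    rw [isOpen_iff_mem_nhds]
    intro w hw
    filter_upwards [hnear w hw.1 hw.2, hQ.isOpen_compl.mem_nhds hw.1] with v h1 h2 using ⟨h2, h1⟩
  have hsub : A ⊆ S := by
    refine hA.subset_of_closure_inter_subset hSopen ⟨z₀, h0, hAQ h0, hf0⟩ ?_
    rintro w ⟨hw, hwA⟩
    refine ⟨hAQ hwA, ?_⟩
    obtain ⟨x, hx, hxw⟩ := mem_closure_iff_seq_limit.1 hw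
    have h1 := (hf.continuousAt (hQ.isOpen_compl.mem_nhds (hAQ hwA))).tendsto.comp hxw
    have h2 : (f ∘ x) = fun _ => C := funext fun n => (hx n).2
    rw [h2] at h1
    exact (tendsto_nhds_unique h1 tendsto_const_nhds)
  exact fun z hz => hnear z (hsub hz).1 (hsub hz).2

/-! ### The Herglotz integral of the indicator of `Q`. -/

/-- The arguments in `[0, 2π)` of the points of `Q` on the unit circle. -/
def angleSet (Q : Set ℂ) : Set ℝ :=
  {t : ℝ | t ∈ Set.Ico 0 (2 * Real.pi) ∧ Complex.exp ((t : ℂ) * Complex.I) ∈ Q}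

/-- The Herglotz integral of the indicator function of `Q` on the unit circle. -/
noncomputable def herglotz (Q : Set ℂ) (z : ℂ) : ℂ :=
  (1 / (2 * Real.pi) : ℝ) * ∫ t in angleSet Q, (Complex.exp ((t : ℂ) * Complex.I) + z) /
    (Complex.exp ((t : ℂ) * Complex.I) - z)

theorem isClosed_preimage_exp {Q : Set ℂ} (hQ : IsClosed Q) :
    IsClosed {t : ℝ | Complex.exp ((t : ℂ) * Complex.I) ∈ Q} :=
  hQ.preimage (f := fun t : ℝ => Complex.exp ((t : ℂ) * Complex.I)) (by fun_prop)

theorem measurableSet_angleSet {Q : Set ℂ} (hQ : IsClosed Q) : MeasurableSet (angleSet Q) :=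
  measurableSet_Ico.inter (isClosed_preimage_exp hQ).measurableSet

theorem volume_angleSet_lt_top (Q : Set ℂ) : volume (angleSet Q) < ⊤ :=
  (measure_mono fun _ ht => ht.1).trans_lt (measure_Ico_lt_top (a := 0) (b := 2 * Real.pi))

instance isFiniteMeasure_restrict_angleSet (Q : Set ℂ) :
    IsFiniteMeasure (volume.restrict (angleSet Q)) :=
  ⟨by simpa using volume_angleSet_lt_top Q⟩

theorem exists_pos_le_norm_sub {Q : Set ℂ} (hQ : IsClosed Q) {z : ℂ} (hz : z ∉ Q) :
    ∃ δ > 0, ∀ ζ ∈ Q, δ ≤ ‖ζ - z‖ := by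
  obtain ⟨δ, hδ, h⟩ := Metric.isOpen_iff.1 hQ.isOpen_compl z hz
  refine ⟨δ, hδ, fun ζ hζ => ?_⟩
  by_contra! hlt
  exact h (by rwa [Metric.mem_ball, dist_eq_norm]) hζ

theorem integrableOn_herglotz_kernel {Q : Set ℂ} (hQ : IsClosed Q) {z : ℂ} (hz : z ∉ Q) :
    IntegrableOn (fun t : ℝ => (Complex.exp ((t : ℂ) * Complex.I) + z) /
      (Complex.exp ((t : ℂ) * Complex.I) - z)) (angleSet Q) := by
  obtain ⟨δ, hδ, h⟩ := exists_pos_le_norm_sub hQ hz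
  refine Integrable.of_bound (C := (1 + ‖z‖) / δ)
    (Measurable.aestronglyMeasurable (by fun_prop)) ?_
  filter_upwards [ae_restrict_mem (measurableSet_angleSet hQ)] with t ht
  rw [norm_div]
  have h1 := norm_add_le (Complex.exp ((t : ℂ) * Complex.I)) z
  rw [Complex.norm_exp_ofReal_mul_I] at h1
  have := h _ ht.2
  gcongr

theorem differentiableAt_herglotz {Q : Set ℂ} (hQ : IsClosed Q) {z : ℂ} (hz : z ∉ Q) :
    DifferentiableAt ℂ (herglotz Q) z := by
  obtain ⟨δ, hδ, h⟩ := exists_pos_le_norm_sub hQ hz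
  refine DifferentiableAt.const_mul (HasDerivAt.differentiableAt
    (hasDerivAt_integral_of_dominated_loc_of_deriv_le (μ := volume.restrict (angleSet Q))
      (F := fun z (t : ℝ) => (Complex.exp ((t : ℂ) * Complex.I) + z) /
        (Complex.exp ((t : ℂ) * Complex.I) - z))
      (F' := fun z (t : ℝ) => 2 * Complex.exp ((t : ℂ) * Complex.I) /
        (Complex.exp ((t : ℂ) * Complex.I) - z) ^ 2)
      (bound := fun _ => 2 / (δ / 2) ^ 2)
      (Metric.ball_mem_nhds z (half_pos hδ)) ?_ (integrableOn_herglotz_kernel hQ hz) ?_ ?_ ?_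
      ?_).2) _
  · exact Eventually.of_forall fun x => Measurable.aestronglyMeasurable (by fun_prop)
  · exact Measurable.aestronglyMeasurable (by fun_prop)
  · filter_upwards [ae_restrict_mem (measurableSet_angleSet hQ)] with t ht x hx
    have h1 := h _ ht.2
    have h2 : δ / 2 ≤ ‖Complex.exp ((t : ℂ) * Complex.I) - x‖ := by
      rw [Metric.mem_ball, dist_eq_norm] at hx
      have := norm_sub_le_norm_sub_add_norm_sub (Complex.exp ((t : ℂ) * Complex.I)) x z
      linarith
    rw [norm_div, norm_mul, Complex.norm_exp_ofReal_mul_I, norm_pow]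
    simp only [Complex.norm_ofNat, mul_one]
    gcongr
  · exact integrable_const _
  · filter_upwards [ae_restrict_mem (measurableSet_angleSet hQ)] with t ht x hx
    have h1 := h _ ht.2
    have h3 : Complex.exp ((t : ℂ) * Complex.I) - x ≠ 0 := by
      intro h0
      rw [Metric.mem_ball, dist_eq_norm] at hx
      have := norm_sub_le_norm_sub_add_norm_sub (Complex.exp ((t : ℂ) * Complex.I)) x z
      rw [h0, norm_zero] at this
      linarith
    have hd : HasDerivAt (fun x => (Complex.exp ((t : ℂ) * Complex.I) + x) /
        (Complex.exp ((t : ℂ) * Complex.I) - x)) _ x :=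
      ((hasDerivAt_id x).const_add (Complex.exp ((t : ℂ) * Complex.I))).div
        ((hasDerivAt_id x).const_sub (Complex.exp ((t : ℂ) * Complex.I))) h3
    refine hd.congr_deriv ?_
    simp only [id]
    ring

theorem re_herglotz {Q : Set ℂ} (hQ : IsClosed Q) {z : ℂ} (hz : z ∉ Q) :
    (herglotz Q z).re = 1 / (2 * Real.pi) *
      ∫ t in angleSet Q, ((Complex.exp ((t : ℂ) * Complex.I) + z) /
        (Complex.exp ((t : ℂ) * Complex.I) - z)).re := by
  unfold herglotz
  rw [Complex.re_ofReal_mul]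
  congr 1
  exact (Complex.reCLM.integral_comp_comm (integrableOn_herglotz_kernel hQ hz)).symm

theorem re_herglotz_kernel (t : ℝ) (z : ℂ) :
    ((Complex.exp ((t : ℂ) * Complex.I) + z) / (Complex.exp ((t : ℂ) * Complex.I) - z)).re =
      (1 - ‖z‖ ^ 2) / ‖Complex.exp ((t : ℂ) * Complex.I) - z‖ ^ 2 := by
  have := congrFun (poissonKernel_eq_re_herglotzRieszKernel (c := 0) (w := z))
    (Complex.exp ((t : ℂ) * Complex.I))
  simp only [poissonKernel_def, herglotzRieszKernel_def, Function.comp, sub_zero,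
    Complex.norm_exp_ofReal_mul_I, one_pow] at this
  exact this.symm

theorem re_herglotz_of_norm_eq_one {Q : Set ℂ} (hQ : IsClosed Q) {z : ℂ} (hz : z ∉ Q)
    (h1 : ‖z‖ = 1) : (herglotz Q z).re = 0 := by
  rw [re_herglotz hQ hz]
  simp [re_herglotz_kernel, h1]

theorem setIntegral_poisson_mem_Icc (Q : Set ℂ) {z : ℂ} (h1 : ‖z‖ < 1) :
    0 ≤ ∫ t in angleSet Q, (1 - ‖z‖ ^ 2) / ‖Complex.exp ((t : ℂ) * Complex.I) - z‖ ^ 2 ∧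
    ∫ t in angleSet Q, (1 - ‖z‖ ^ 2) / ‖Complex.exp ((t : ℂ) * Complex.I) - z‖ ^ 2
      ≤ 2 * Real.pi := by
  have hnn : ∀ t : ℝ, 0 ≤ (1 - ‖z‖ ^ 2) / ‖Complex.exp ((t : ℂ) * Complex.I) - z‖ ^ 2 := by
    intro t
    have : ‖z‖ ^ 2 ≤ 1 := pow_le_one₀ (norm_nonneg _) h1.le
    exact div_nonneg (by linarith) (by positivity)
  refine ⟨integral_nonneg hnn, ?_⟩
  have hne : ∀ t : ℝ, ‖Complex.exp ((t : ℂ) * Complex.I) - z‖ ^ 2 ≠ 0 := by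
    intro t h0
    have : Complex.exp ((t : ℂ) * Complex.I) = z := by
      simpa [sub_eq_zero] using h0
    rw [← this, Complex.norm_exp_ofReal_mul_I] at h1
    exact lt_irrefl _ h1
  have hcont : Continuous fun t : ℝ =>
      (1 - ‖z‖ ^ 2) / ‖Complex.exp ((t : ℂ) * Complex.I) - z‖ ^ 2 :=
    Continuous.div (by fun_prop) (by fun_prop) hne
  have havg := DiffContOnCl.circleAverage_re_herglotzRieszKernel_smul' (c := 0) (R := 1) (w := z)
    (f := fun _ => (1 : ℂ)) diffContOnCl_const (by simpa using h1)
  rw [Real.circleAverage_def] at havg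
  simp only [sub_zero, circleMap_zero, Complex.ofReal_one, one_mul, re_herglotz_kernel,
    Complex.real_smul, mul_one, intervalIntegral.integral_ofReal] at havg
  norm_cast at havg
  have hint : ∫ t in (0 : ℝ)..2 * Real.pi,
      (1 - ‖z‖ ^ 2) / ‖Complex.exp ((t : ℂ) * Complex.I) - z‖ ^ 2 = 2 * Real.pi := by
    have hpi := Real.pi_pos
    field_simp at havg
    linarith
  rw [intervalIntegral.integral_of_le (by positivity), ← integral_Ico_eq_integral_Ioc] at hint
  rw [← hint]
  refine setIntegral_mono_set ?_ (Eventually.of_forall hnn)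
    (LE.le.eventuallyLE fun t ht => ht.1)
  exact (hcont.integrableOn_Icc (a := 0) (b := 2 * Real.pi)).mono_set Set.Ico_subset_Icc_self

/-- The Poisson kernel is odd under reflection in the circle; this transfers the bound on harmonic
measure from the disc to its exterior. -/
theorem poisson_kernel_inversion (t : ℝ) {z : ℂ} (hz : z ≠ 0) :
    (1 - ‖z‖ ^ 2) / ‖Complex.exp ((t : ℂ) * Complex.I) - z‖ ^ 2 =
      -((1 - ‖(starRingEnd ℂ z)⁻¹‖ ^ 2) /
        ‖Complex.exp ((t : ℂ) * Complex.I) - (starRingEnd ℂ z)⁻¹‖ ^ 2) := by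
  have hz' : starRingEnd ℂ z ≠ 0 := by simpa using hz
  have h1 : ‖Complex.exp ((t : ℂ) * Complex.I) - (starRingEnd ℂ z)⁻¹‖ =
      ‖Complex.exp ((t : ℂ) * Complex.I) - z‖ / ‖z‖ := by
    rw [eq_div_iff (norm_ne_zero_iff.2 hz)]
    conv_lhs => rw [← Complex.norm_conj z, ← norm_mul, sub_mul, inv_mul_cancel₀ hz']
    rw [← Complex.norm_conj (Complex.exp _ - z), map_sub, ← Complex.exp_conj]
    have h2 : Complex.exp ((t : ℂ) * Complex.I) * Complex.exp (starRingEnd ℂ (t * Complex.I)) = 1 := by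
      rw [← Complex.exp_add]; simp
    rw [← h2, ← mul_sub, norm_mul, Complex.norm_exp_ofReal_mul_I, one_mul, norm_sub_rev]
  rw [h1, norm_inv, Complex.norm_conj]
  have : ‖z‖ ≠ 0 := norm_ne_zero_iff.2 hz
  by_cases h0 : ‖Complex.exp ((t : ℂ) * Complex.I) - z‖ = 0
  · simp [h0]
  · field_simp
    ring

theorem abs_re_herglotz_le_one {Q : Set ℂ} (hQ : IsClosed Q) {z : ℂ} (hz : z ∉ Q) :
    |(herglotz Q z).re| ≤ 1 := by
  have hpi := Real.pi_pos
  have aux : ∀ x : ℝ, 0 ≤ x → x ≤ 2 * Real.pi → |1 / (2 * Real.pi) * x| ≤ 1 := by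
    intro x h0 h1
    rw [abs_of_nonneg (by positivity), one_div_mul_eq_div, div_le_one (by positivity)]
    exact h1
  rcases lt_trichotomy ‖z‖ 1 with h | h | h
  · rw [re_herglotz hQ hz]
    simp only [re_herglotz_kernel]
    exact aux _ (setIntegral_poisson_mem_Icc Q h).1 (setIntegral_poisson_mem_Icc Q h).2
  · simp [re_herglotz_of_norm_eq_one hQ hz h]
  · have hz0 : z ≠ 0 := by rintro rfl; simp at h; linarith
    have h' : ‖(starRingEnd ℂ z)⁻¹‖ < 1 := by
      rw [norm_inv, Complex.norm_conj]; exact inv_lt_one_of_one_lt₀ h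
    rw [re_herglotz hQ hz]
    simp only [re_herglotz_kernel, fun t => poisson_kernel_inversion t hz0]
    rw [integral_neg, mul_neg, abs_neg]
    exact aux _ (setIntegral_poisson_mem_Icc Q h').1 (setIntegral_poisson_mem_Icc Q h').2

theorem herglotz_zero {Q : Set ℂ} {α : ℝ} (hα : 0 ≤ α)
    (hm : volume (angleSet Q) = ENNReal.ofReal (2 * α)) : herglotz Q 0 = (α / Real.pi : ℝ) := by
  unfold herglotz
  have : ∀ t : ℝ, (Complex.exp ((t : ℂ) * Complex.I) + 0) /
    (Complex.exp ((t : ℂ) * Complex.I) - 0) = 1 := fun t => by simp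
  simp only [this, setIntegral_const, Measure.real, hm]
  rw [ENNReal.toReal_ofReal (by positivity)]
  have := Real.pi_ne_zero
  simp
  field_simp

/-- The kernel tends to `-1` at infinity and is `1` at the origin, so `herglotz` tends to `-α/π`,
with error of order `1/‖z‖`. This makes `herglotzDisc` vanish at infinity. -/
theorem norm_herglotz_add_le {Q : Set ℂ} (hQ : IsClosed Q) (hQs : Q ⊆ unitCircle) {α : ℝ}
    (hα : 0 ≤ α) (hm : volume (angleSet Q) = ENNReal.ofReal (2 * α)) {z : ℂ} (hz : 2 ≤ ‖z‖) :
    ‖herglotz Q z + (α / Real.pi : ℝ)‖ ≤ (4 * α / Real.pi) / ‖z‖ := by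
  have hzQ : z ∉ Q := fun h => by
    have := hQs h
    simp [unitCircle] at this
    linarith
  have hpi := Real.pi_pos
  rw [← herglotz_zero hα hm]
  unfold herglotz
  rw [← mul_add, ← integral_add (integrableOn_herglotz_kernel hQ hzQ)]
  swap
  · have : ∀ t : ℝ, (Complex.exp ((t : ℂ) * Complex.I) + 0) /
      (Complex.exp ((t : ℂ) * Complex.I) - 0) = 1 := fun t => by simp
    simp only [this]
    exact integrable_const _
  have hb : ‖∫ t in angleSet Q, ((Complex.exp ((t : ℂ) * Complex.I) + z) /
      (Complex.exp ((t : ℂ) * Complex.I) - z) + (Complex.exp ((t : ℂ) * Complex.I) + 0) /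
      (Complex.exp ((t : ℂ) * Complex.I) - 0))‖ ≤ 4 / ‖z‖ * (volume (angleSet Q)).toReal := by
    refine norm_setIntegral_le_of_norm_le_const (volume_angleSet_lt_top Q) fun t _ => ?_
    set ζ := Complex.exp ((t : ℂ) * Complex.I) with hζ
    have hζ1 : ‖ζ‖ = 1 := Complex.norm_exp_ofReal_mul_I t
    have hζ0 : ζ ≠ 0 := Complex.exp_ne_zero _
    have hge : ‖z‖ / 2 ≤ ‖ζ - z‖ := by
      have := norm_sub_norm_le z ζ
      rw [norm_sub_rev] at this
      linarith
    have hne : ζ - z ≠ 0 := norm_pos_iff.1 (by linarith)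
    have : (ζ + z) / (ζ - z) + (ζ + 0) / (ζ - 0) = 2 * ζ / (ζ - z) := by
      rw [add_zero, sub_zero, div_self hζ0]
      field_simp
      ring
    rw [this, norm_div, norm_mul, hζ1]
    simp only [Complex.norm_ofNat, mul_one]
    calc 2 / ‖ζ - z‖ ≤ 2 / (‖z‖ / 2) := by gcongr
      _ = 4 / ‖z‖ := by ring
  rw [hm, ENNReal.toReal_ofReal (by positivity)] at hb
  rw [norm_mul, Complex.norm_real, Real.norm_of_nonneg (by positivity)]
  calc _ ≤ 1 / (2 * Real.pi) * (4 / ‖z‖ * (2 * α)) := by gcongr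
    _ = _ := by field_simp

/-! ### The bounded holomorphic function `B = herglotzDisc` off `Q`. -/

/-- The exponential of the Herglotz integral; it maps the complement of `Q` into the right
half-plane. -/
noncomputable def herglotzExp (Q : Set ℂ) (z : ℂ) : ℂ :=
  Complex.exp (Complex.I * (Real.pi / 2 : ℝ) * herglotz Q z)

/-- The holomorphic function on the complement of `Q`, bounded by one and vanishing at infinity,
obtained from `herglotzExp` by a Möbius map of the right half-plane to the disc. -/
noncomputable def herglotzDisc (Q : Set ℂ) (α : ℝ) (z : ℂ) : ℂ :=
  (herglotzExp Q z - Complex.exp (((-(α / 2) : ℝ) : ℂ) * Complex.I)) /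
    (herglotzExp Q z + Complex.exp (((α / 2 : ℝ) : ℂ) * Complex.I))

theorem herglotzExp_re_nonneg {Q : Set ℂ} (hQ : IsClosed Q) {z : ℂ} (hz : z ∉ Q) :
    0 ≤ (herglotzExp Q z).re := by
  have h := abs_le.1 (abs_re_herglotz_le_one hQ hz)
  have hpi := Real.pi_pos
  unfold herglotzExp
  rw [Complex.exp_re]
  refine mul_nonneg (Real.exp_nonneg _) (Real.cos_nonneg_of_mem_Icc ?_)
  have : (Complex.I * (Real.pi / 2 : ℝ) * herglotz Q z).im = Real.pi / 2 * (herglotz Q z).re := by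
    simp [mul_assoc]
  rw [this]
  constructor <;> nlinarith

theorem herglotzExp_of_norm_eq_one {Q : Set ℂ} (hQ : IsClosed Q) {z : ℂ} (hz : z ∉ Q)
    (h1 : ‖z‖ = 1) : ∃ x : ℝ, 0 < x ∧ herglotzExp Q z = x := by
  refine ⟨Real.exp (-(Real.pi / 2 * (herglotz Q z).im)), Real.exp_pos _, ?_⟩
  unfold herglotzExp
  rw [Complex.ofReal_exp]
  congr 1
  apply Complex.ext <;> simp [mul_assoc, re_herglotz_of_norm_eq_one hQ hz h1]

theorem differentiableAt_herglotzExp {Q : Set ℂ} (hQ : IsClosed Q) {z : ℂ} (hz : z ∉ Q) :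
    DifferentiableAt ℂ (herglotzExp Q) z :=
  ((differentiableAt_herglotz hQ hz).const_mul _).cexp

theorem cos_half_pos {α : ℝ} (h0 : 0 < α) (hπ : α < Real.pi) : 0 < Real.cos (α / 2) :=
  Real.cos_pos_of_mem_Ioo ⟨by linarith, by linarith⟩

theorem sin_half_pos {α : ℝ} (h0 : 0 < α) (hπ : α < Real.pi) : 0 < Real.sin (α / 2) :=
  Real.sin_pos_of_pos_of_lt_pi (by linarith) (by linarith)

theorem cos_half_le_norm_herglotzExp_add {Q : Set ℂ} (hQ : IsClosed Q) (α : ℝ) {z : ℂ}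
    (hz : z ∉ Q) :
    Real.cos (α / 2) ≤ ‖herglotzExp Q z + Complex.exp (((α / 2 : ℝ) : ℂ) * Complex.I)‖ := by
  refine le_trans ?_ (Complex.re_le_norm _)
  rw [Complex.add_re, Complex.exp_ofReal_mul_I_re]
  linarith [herglotzExp_re_nonneg hQ hz]

theorem herglotzExp_add_ne_zero {Q : Set ℂ} (hQ : IsClosed Q) {α : ℝ} (h0 : 0 < α)
    (hπ : α < Real.pi) {z : ℂ} (hz : z ∉ Q) :
    herglotzExp Q z + Complex.exp (((α / 2 : ℝ) : ℂ) * Complex.I) ≠ 0 :=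
  norm_pos_iff.1 ((cos_half_pos h0 hπ).trans_le (cos_half_le_norm_herglotzExp_add hQ α hz))

theorem differentiableAt_herglotzDisc {Q : Set ℂ} (hQ : IsClosed Q) {α : ℝ} (h0 : 0 < α)
    (hπ : α < Real.pi) {z : ℂ} (hz : z ∉ Q) : DifferentiableAt ℂ (herglotzDisc Q α) z :=
  ((differentiableAt_herglotzExp hQ hz).sub_const _).div
    ((differentiableAt_herglotzExp hQ hz).add_const _) (herglotzExp_add_ne_zero hQ h0 hπ hz)

/-- The pole `-e^{iα/2}` is the mirror image of the zero `e^{-iα/2}` in the imaginary axis, so a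
point of the right half-plane is no farther from the zero than from the pole. -/
theorem norm_herglotzDisc_le_one {Q : Set ℂ} (hQ : IsClosed Q) {α : ℝ} (h0 : 0 < α)
    (hπ : α < Real.pi) {z : ℂ} (hz : z ∉ Q) : ‖herglotzDisc Q α z‖ ≤ 1 := by
  have hc := cos_half_pos h0 hπ
  have hs := herglotzExp_re_nonneg hQ hz
  unfold herglotzDisc
  rw [norm_div]
  refine div_le_one_of_le₀ ?_ (norm_nonneg _)
  rw [← sq_le_sq₀ (norm_nonneg _) (norm_nonneg _), ← Complex.normSq_eq_norm_sq,
    ← Complex.normSq_eq_norm_sq, Complex.normSq_apply, Complex.normSq_apply]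
  simp only [Complex.sub_re, Complex.sub_im, Complex.add_re, Complex.add_im,
    Complex.exp_ofReal_mul_I_re, Complex.exp_ofReal_mul_I_im, Real.cos_neg, Real.sin_neg]
  nlinarith [mul_nonneg hs hc.le]

theorem norm_herglotzDisc_zero {Q : Set ℂ} {α : ℝ} (h0 : 0 < α) (hπ : α < Real.pi)
    (hm : volume (angleSet Q) = ENNReal.ofReal (2 * α)) :
    ‖herglotzDisc Q α 0‖ = Real.sin (α / 2) := by
  have hpi : (Real.pi : ℂ) ≠ 0 := by exact_mod_cast Real.pi_ne_zero
  have h1 : herglotzExp Q 0 = Complex.exp (((α / 2 : ℝ) : ℂ) * Complex.I) := by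
    unfold herglotzExp
    rw [herglotz_zero h0.le hm]
    congr 1
    push_cast
    field_simp
  have h2 : Complex.exp (((α / 2 : ℝ) : ℂ) * Complex.I) -
      Complex.exp (((-(α / 2) : ℝ) : ℂ) * Complex.I) = ((2 * Real.sin (α / 2) : ℝ) : ℂ) * Complex.I := by
    apply Complex.ext
    · simp [Complex.exp_ofReal_mul_I_re, -Complex.ofReal_div, -Complex.ofReal_neg,
        -Complex.ofReal_mul]
    · simp only [Complex.sub_im, Complex.exp_ofReal_mul_I_im, Real.sin_neg, Complex.im_ofReal_mul,
        Complex.I_im]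
      ring
  unfold herglotzDisc
  rw [h1, h2, norm_div, norm_mul, Complex.norm_I, ← two_mul, norm_mul,
    Complex.norm_exp_ofReal_mul_I, Complex.norm_real,
    Real.norm_of_nonneg (by linarith [sin_half_pos h0 hπ])]
  simp

theorem norm_herglotzDisc_le {Q : Set ℂ} (hQ : IsClosed Q) (hQs : Q ⊆ unitCircle) {α : ℝ}
    (h0 : 0 < α) (hπ : α < Real.pi) (hm : volume (angleSet Q) = ENNReal.ofReal (2 * α))
    {z : ℂ} (hz : 8 ≤ ‖z‖) :
    ‖herglotzDisc Q α z‖ ≤ (4 * α / Real.cos (α / 2)) / ‖z‖ := by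
  have hzQ : z ∉ Q := fun h => by
    have := hQs h
    simp [unitCircle] at this
    linarith
  have hpi := Real.pi_pos
  have hpi4 := Real.pi_le_four
  have hzp : 0 < ‖z‖ := by linarith
  have hu := norm_herglotz_add_le hQ hQs h0.le hm (z := z) (by linarith)
  have hc := cos_half_pos h0 hπ
  have hcs := cos_half_le_norm_herglotzExp_add hQ α hzQ
  set w : ℂ := Complex.I * (Real.pi / 2 : ℝ) * (herglotz Q z + (α / Real.pi : ℝ)) with hw
  have hwn : ‖w‖ ≤ 2 * α / ‖z‖ := by
    rw [hw, norm_mul, norm_mul, Complex.norm_I, Complex.norm_real,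
      Real.norm_of_nonneg (by positivity), one_mul]
    calc _ ≤ Real.pi / 2 * (4 * α / Real.pi / ‖z‖) := by gcongr
      _ = _ := by field_simp; ring
  -- The threshold `8` comes from here: `2α < 2π ≤ 8 ≤ ‖z‖`.
  have hw1 : ‖w‖ ≤ 1 := hwn.trans (by rw [div_le_one hzp]; linarith)
  have hs : herglotzExp Q z - Complex.exp (((-(α / 2) : ℝ) : ℂ) * Complex.I) =
      Complex.exp (((-(α / 2) : ℝ) : ℂ) * Complex.I) * (Complex.exp w - 1) := by
    rw [mul_sub, mul_one, ← Complex.exp_add]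
    unfold herglotzExp
    congr 2
    have hpi : (Real.pi : ℂ) ≠ 0 := by exact_mod_cast Real.pi_ne_zero
    rw [hw]
    push_cast
    field_simp
    ring
  unfold herglotzDisc
  rw [norm_div, hs, norm_mul, Complex.norm_exp_ofReal_mul_I, one_mul]
  calc _ ≤ (2 * (2 * α / ‖z‖)) / Real.cos (α / 2) := by
        have := Complex.norm_exp_sub_one_le hw1
        gcongr
        linarith
    _ = _ := by field_simp; ring

/-! ### The lower bound for polynomials with zeros on the circle. -/

section Bound

variable {m : ℕ} (ξ : Fin m → ℂ) (M : ℝ)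

/-- The polynomial function with zeros `ξ`. -/
def zerosProd (z : ℂ) : ℂ := ∏ j, (z - ξ j)

/-- The discriminant `P(z)² - P(0) M² z ^ m`. -/
def zerosDisc (z : ℂ) : ℂ := zerosProd ξ z ^ 2 - zerosProd ξ 0 * M ^ 2 * z ^ m

/-- The modulus of the larger root of `X² - 2 P(z) X + P(0) M² z ^ m`. -/
noncomputable def zerosEnvelope (z : ℂ) : ℝ := rootEnvelope (zerosProd ξ z) (zerosDisc ξ M z)

theorem differentiable_zerosProd : Differentiable ℂ (zerosProd ξ) := by
  unfold zerosProd; fun_prop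

theorem differentiable_zerosDisc : Differentiable ℂ (zerosDisc ξ M) := by
  have := differentiable_zerosProd ξ
  unfold zerosDisc; fun_prop

theorem continuous_zerosEnvelope : Continuous (zerosEnvelope ξ M) :=
  continuous_rootEnvelope.comp
    ((differentiable_zerosProd ξ).continuous.prodMk (differentiable_zerosDisc ξ M).continuous)

theorem hasHolomorphicSupportAt_zerosEnvelope (z : ℂ) :
    HasHolomorphicSupportAt (zerosEnvelope ξ M) z :=
  hasHolomorphicSupportAt_rootEnvelope (differentiable_zerosProd ξ) (differentiable_zerosDisc ξ M) z

variable {ξ} (hξ : ∀ j, ‖ξ j‖ = 1)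
include hξ

theorem norm_zerosProd_zero : ‖zerosProd ξ 0‖ = 1 := by
  simp [zerosProd, norm_prod, hξ]

theorem zerosProd_sq {z : ℂ} (hz : ‖z‖ = 1) :
    zerosProd ξ z ^ 2 = zerosProd ξ 0 * z ^ m * (‖zerosProd ξ z‖ ^ 2 : ℝ) := by
  have h1 : ∀ j, (z - ξ j) ^ 2 = (0 - ξ j) * z * (‖z - ξ j‖ ^ 2 : ℝ) := by
    intro j
    have hz0 : z * starRingEnd ℂ z = 1 := by
      rw [Complex.mul_conj, Complex.normSq_eq_norm_sq, hz]; simp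
    have hj0 : ξ j * starRingEnd ℂ (ξ j) = 1 := by
      rw [Complex.mul_conj, Complex.normSq_eq_norm_sq, hξ]; simp
    rw [← Complex.normSq_eq_norm_sq, ← Complex.mul_conj, map_sub]
    linear_combination ((-z ^ 2 + z * ξ j) * hj0 + (z * ξ j - ξ j ^ 2) * hz0)
  unfold zerosProd
  rw [← Finset.prod_pow, Finset.prod_congr rfl fun j _ => h1 j, Finset.prod_mul_distrib,
    Finset.prod_mul_distrib, Finset.prod_const, norm_prod, ← Finset.prod_pow]
  simp

theorem zerosDisc_of_norm_eq_one {z : ℂ} (hz : ‖z‖ = 1) :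
    zerosDisc ξ M z = zerosProd ξ 0 * z ^ m * ((‖zerosProd ξ z‖ ^ 2 - M ^ 2 : ℝ) : ℂ) := by
  unfold zerosDisc
  rw [zerosProd_sq hξ hz]
  push_cast
  ring

theorem norm_zerosProd_sq_sub {z : ℂ} :
    ‖zerosProd ξ z ^ 2 - zerosDisc ξ M z‖ = M ^ 2 * ‖z‖ ^ m := by
  unfold zerosDisc
  rw [sub_sub_cancel, norm_mul, norm_mul, norm_zerosProd_zero hξ]
  simp

/-- Here `‖Y‖ = M² - ‖P‖²`, so `‖P‖² + ‖Y‖` and `‖P² - Y‖` both equal `M²` and the inner root in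
`rootEnvelope` vanishes. -/
theorem zerosEnvelope_eq_of_le (hM : 0 ≤ M) {z : ℂ} (hz : ‖z‖ = 1) (hle : ‖zerosProd ξ z‖ ≤ M) :
    zerosEnvelope ξ M z = M := by
  unfold zerosEnvelope rootEnvelope
  rw [norm_zerosProd_sq_sub M hξ, zerosDisc_of_norm_eq_one M hξ hz, norm_mul, norm_mul,
    norm_zerosProd_zero hξ, norm_pow, hz, Complex.norm_real, Real.norm_of_nonpos
      (by have := norm_nonneg (zerosProd ξ z); nlinarith)]
  simp [Real.sqrt_sq hM]

theorem zerosEnvelope_zero (hm : 1 ≤ m) : zerosEnvelope ξ M 0 = 2 := by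
  have : zerosDisc ξ M 0 = zerosProd ξ 0 ^ 2 := by
    simp [zerosDisc, zero_pow (by omega : m ≠ 0)]
  unfold zerosEnvelope
  rw [this, rootEnvelope_sq_eq_max, sub_self, ← two_mul, norm_mul, norm_zerosProd_zero hξ]
  simp

theorem zerosEnvelope_le {z : ℂ} (hz : 1 ≤ ‖z‖) :
    zerosEnvelope ξ M z ≤ (2 ^ m + √(4 ^ m + M ^ 2)) * ‖z‖ ^ m := by
  have hP : ‖zerosProd ξ z‖ ≤ 2 ^ m * ‖z‖ ^ m := by
    unfold zerosProd
    rw [norm_prod, ← mul_pow]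
    calc ∏ j, ‖z - ξ j‖ ≤ ∏ _j : Fin m, (2 * ‖z‖) := by
          refine Finset.prod_le_prod (fun _ _ => norm_nonneg _) fun j _ => ?_
          have := norm_sub_le z (ξ j)
          rw [hξ] at this
          linarith
      _ = _ := by simp
  have hY : ‖zerosDisc ξ M z‖ ≤ (4 ^ m + M ^ 2) * (‖z‖ ^ m) ^ 2 := by
    have h1 : ‖zerosProd ξ z‖ ^ 2 ≤ (2 ^ m * ‖z‖ ^ m) ^ 2 := by gcongr
    have h2 : ‖zerosDisc ξ M z‖ ≤ ‖zerosProd ξ z ^ 2‖ + ‖zerosProd ξ z ^ 2 - zerosDisc ξ M z‖ := by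
      have := norm_sub_le (zerosProd ξ z ^ 2) (zerosProd ξ z ^ 2 - zerosDisc ξ M z)
      rwa [sub_sub_cancel] at this
    rw [norm_zerosProd_sq_sub M hξ, norm_pow] at h2
    have h3 : ‖z‖ ^ m ≤ (‖z‖ ^ m) ^ 2 := le_self_pow₀ (one_le_pow₀ hz) two_ne_zero
    have h4 : (2 ^ m * ‖z‖ ^ m) ^ 2 = 4 ^ m * (‖z‖ ^ m) ^ 2 := by
      rw [mul_pow, ← pow_mul, mul_comm m 2, pow_mul]; norm_num
    have h5 := mul_le_mul_of_nonneg_left h3 (sq_nonneg M)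
    linarith
  refine (rootEnvelope_le _ _).trans ?_
  rw [add_mul]
  refine add_le_add hP ?_
  calc √‖zerosDisc ξ M z‖ ≤ √((4 ^ m + M ^ 2) * (‖z‖ ^ m) ^ 2) := Real.sqrt_le_sqrt hY
    _ = _ := by rw [Real.sqrt_mul (by positivity), Real.sqrt_sq (by positivity)]

/-- `E|B|^m` is only bounded at infinity. Raising it to the power `k` and spending one extra factor
`|B|` forces decay to `0`, as the maximum principle requires. -/
theorem zerosEnvelope_pow_mul_le {Q : Set ℂ} (hQ : IsClosed Q) (hQs : Q ⊆ unitCircle) {α : ℝ}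
    (h0 : 0 < α) (hπ : α < Real.pi) (hm : volume (angleSet Q) = ENNReal.ofReal (2 * α))
    (hM : 0 ≤ M) (hPM : ∀ z ∈ Q, ‖zerosProd ξ z‖ ≤ M) (k : ℕ) {z : ℂ} (hz : z ∉ Q) :
    zerosEnvelope ξ M z ^ k * ‖herglotzDisc Q α z‖ ^ (m * k + 1) ≤ M ^ k := by
  have hdiff : ∀ z ∈ Qᶜ, DifferentiableAt ℂ (herglotzDisc Q α) z :=
    fun z hz => differentiableAt_herglotzDisc hQ h0 hπ hz
  have hsupp : ∀ z ∈ Qᶜ, HasHolomorphicSupportAt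
      (fun z => zerosEnvelope ξ M z ^ k * ‖herglotzDisc Q α z‖ ^ (m * k + 1)) z := by
    intro z hz
    simp only [← norm_pow]
    refine ((hasHolomorphicSupportAt_zerosEnvelope ξ M z).pow k).mul_norm ?_
    filter_upwards [hQ.isOpen_compl.mem_nhds hz] with w hw using (hdiff w hw).pow _
  refine le_of_hasHolomorphicSupport hQ (F := fun z => zerosEnvelope ξ M z ^ k)
    (f := fun z => zerosEnvelope ξ M z ^ k * ‖herglotzDisc Q α z‖ ^ (m * k + 1))
    (pow_nonneg hM k) ?_ hsupp ((continuous_zerosEnvelope ξ M).pow k) ?_ ?_ ?_ hz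
  · have : ContinuousOn (herglotzDisc Q α) Qᶜ :=
      fun z hz => (hdiff z hz).continuousAt.continuousWithinAt
    exact ((continuous_zerosEnvelope ξ M).pow k).continuousOn.mul (this.norm.pow _)
  · intro w hw
    exact mul_le_of_le_one_right (pow_nonneg (rootEnvelope_nonneg _ _) _)
      (pow_le_one₀ (norm_nonneg _) (norm_herglotzDisc_le_one hQ h0 hπ hw))
  · intro w hw
    have hw1 : ‖w‖ = 1 := by simpa [unitCircle] using hQs hw
    simp only [zerosEnvelope_eq_of_le M hξ hM hw1 (hPM w hw), le_refl]
  · set C₁ := 2 ^ m + √(4 ^ m + M ^ 2)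
    set C₂ := 4 * α / Real.cos (α / 2)
    have hC : Tendsto (fun w : ℂ => C₁ ^ k * C₂ ^ (m * k + 1) / ‖w‖) (cocompact ℂ) (𝓝 0) :=
      tendsto_norm_cocompact_atTop.const_div_atTop _
    refine tendsto_of_tendsto_of_tendsto_of_le_of_le' tendsto_const_nhds hC
      (Eventually.of_forall fun w => mul_nonneg (pow_nonneg (rootEnvelope_nonneg _ _) _)
        (by positivity)) ?_
    filter_upwards [(tendsto_norm_cocompact_atTop (E := ℂ)).eventually_ge_atTop 8] with w hw
    have hw0 : 0 < ‖w‖ := by linarith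
    have h1 := zerosEnvelope_le M hξ (z := w) (by linarith)
    have h2 := norm_herglotzDisc_le hQ hQs h0 hπ hm hw
    calc _ ≤ (C₁ * ‖w‖ ^ m) ^ k * (C₂ / ‖w‖) ^ (m * k + 1) := by
          gcongr
          exact rootEnvelope_nonneg _ _
      _ = _ := by
          rw [mul_pow, div_pow, ← pow_mul, pow_succ ‖w‖]
          field_simp

theorem zerosEnvelope_mul_le {Q : Set ℂ} (hQ : IsClosed Q) (hQs : Q ⊆ unitCircle) {α : ℝ}
    (h0 : 0 < α) (hπ : α < Real.pi) (hm : volume (angleSet Q) = ENNReal.ofReal (2 * α))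
    (hM : 0 ≤ M) (hPM : ∀ z ∈ Q, ‖zerosProd ξ z‖ ≤ M) (hm1 : 1 ≤ m) {z : ℂ} (hz : z ∉ Q) :
    zerosEnvelope ξ M z * ‖herglotzDisc Q α z‖ ^ m ≤ M := by
  set x := zerosEnvelope ξ M z * ‖herglotzDisc Q α z‖ ^ m with hx
  -- The surplus factor `‖B‖` does not depend on `k`; letting `k` grow removes it.
  have key : ∀ k : ℕ, x ^ k * ‖herglotzDisc Q α z‖ ≤ M ^ k := by
    intro k
    have := zerosEnvelope_pow_mul_le M hξ hQ hQs h0 hπ hm hM hPM k hz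
    rwa [pow_succ, ← mul_assoc, pow_mul, ← mul_pow] at this
  rcases eq_or_lt_of_le (norm_nonneg (herglotzDisc Q α z)) with hb | hb
  · rw [hx, ← hb, zero_pow (by omega), mul_zero]; exact hM
  by_contra! hlt
  rcases eq_or_lt_of_le hM with hM0 | hM0
  · have h1 := key 1
    have : 0 < x := by linarith
    rw [← hM0] at h1
    simp only [pow_one] at h1
    nlinarith [mul_pos this hb]
  · obtain ⟨k, hk⟩ := pow_unbounded_of_one_lt (1 / ‖herglotzDisc Q α z‖) ((one_lt_div hM0).2 hlt)
    rw [div_pow, div_lt_div_iff₀ hb (by positivity), one_mul] at hk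
    exact absurd (key k) (not_le.2 hk)

theorem two_mul_sin_pow_le {Q : Set ℂ} (hQ : IsClosed Q) (hQs : Q ⊆ unitCircle) {α : ℝ}
    (h0 : 0 < α) (hπ : α < Real.pi) (hm : volume (angleSet Q) = ENNReal.ofReal (2 * α))
    (hM : 0 ≤ M) (hPM : ∀ z ∈ Q, ‖zerosProd ξ z‖ ≤ M) (hm1 : 1 ≤ m) :
    2 * Real.sin (α / 2) ^ m ≤ M := by
  have hz : (0 : ℂ) ∉ Q := fun h => by simpa [unitCircle] using hQs h
  have := zerosEnvelope_mul_le M hξ hQ hQs h0 hπ hm hM hPM hm1 hz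
  rwa [zerosEnvelope_zero M hξ hm1, norm_herglotzDisc_zero h0 hπ hm] at this

end Bound

/-! ### The equality case: the phase of `B` on the gaps of `Q`. -/

theorem herglotzDisc_of_norm_eq_one {Q : Set ℂ} (hQ : IsClosed Q) {α : ℝ} (h0 : 0 < α)
    (hπ : α < Real.pi) {z : ℂ} (hz : z ∉ Q) (h1 : ‖z‖ = 1) :
    0 < (herglotzDisc Q α z).im ∧ ‖herglotzDisc Q α z‖ < 1 ∧
    (Complex.exp (((α / 2 : ℝ) : ℂ) * Complex.I) * herglotzDisc Q α z).im =
      Real.sin (α / 2) * ((1 + ‖herglotzDisc Q α z‖ ^ 2) / 2) := by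
  -- On the circle off `Q` the Herglotz integral is purely imaginary, so `B` is the Möbius image of
  -- a positive number `x`. Such images lie on a circular arc in the upper half-disc, and the last
  -- identity is the equation of its circle.
  obtain ⟨x, hx, hsx⟩ := herglotzExp_of_norm_eq_one hQ hz h1
  have hc := cos_half_pos h0 hπ
  have hd := sin_half_pos h0 hπ
  have hcd := Real.sin_sq_add_cos_sq (α / 2)
  set c := Real.cos (α / 2) with hcdef
  set d := Real.sin (α / 2) with hddef
  set D := (x + c) ^ 2 + d ^ 2 with hD
  have hDpos : 0 < D := by positivity
  have hre : (herglotzDisc Q α z).re = (x ^ 2 - c ^ 2 + d ^ 2) / D := by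
    unfold herglotzDisc
    rw [hsx, Complex.div_re, Complex.normSq_apply]
    simp only [Complex.sub_re, Complex.sub_im, Complex.add_re, Complex.add_im, Complex.ofReal_re,
      Complex.ofReal_im, Complex.exp_ofReal_mul_I_re, Complex.exp_ofReal_mul_I_im, Real.cos_neg,
      Real.sin_neg, ← hcdef, ← hddef]
    rw [← add_div]
    congr 1 <;> ring
  have him : (herglotzDisc Q α z).im = 2 * c * d / D := by
    unfold herglotzDisc
    rw [hsx, Complex.div_im, Complex.normSq_apply]
    simp only [Complex.sub_re, Complex.sub_im, Complex.add_re, Complex.add_im, Complex.ofReal_re,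
      Complex.ofReal_im, Complex.exp_ofReal_mul_I_re, Complex.exp_ofReal_mul_I_im, Real.cos_neg,
      Real.sin_neg, ← hcdef, ← hddef]
    rw [← sub_div]
    congr 1 <;> ring
  have hn : ‖herglotzDisc Q α z‖ ^ 2 = ((x - c) ^ 2 + d ^ 2) / D := by
    rw [← Complex.normSq_eq_norm_sq, Complex.normSq_apply, hre, him]
    field_simp
    rw [hD]; ring
  refine ⟨by rw [him]; positivity, ?_, ?_⟩
  · rw [← sq_lt_one_iff₀ (norm_nonneg _), hn, div_lt_one hDpos, hD]
    nlinarith [mul_pos hx hc]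
  · rw [hn, Complex.mul_im, Complex.exp_ofReal_mul_I_re, Complex.exp_ofReal_mul_I_im, hre, him,
      ← hcdef, ← hddef]
    field_simp
    rw [hD]
    ring

theorem eq_zero_or_of_sin_add_eq {α A : ℝ} (h0 : 0 < α) (hπ : α < Real.pi) (hA0 : 0 ≤ A)
    (hAπ : A ≤ Real.pi) (h : Real.sin (α / 2 + A) = Real.sin (α / 2)) :
    A = 0 ∨ A = Real.pi - α := by
  have h1 := Real.sin_sub_sin (α / 2 + A) (α / 2)
  rw [h, sub_self] at h1
  have h2 : Real.sin (A / 2) * Real.cos ((α + A) / 2) = 0 := by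
    rw [show (α / 2 + A - α / 2) / 2 = A / 2 by ring,
      show (α / 2 + A + α / 2) / 2 = (α + A) / 2 by ring] at h1
    linarith
  rcases mul_eq_zero.1 h2 with h3 | h3
  · left
    rcases hA0.eq_or_lt with h4 | h4
    · exact h4.symm
    · exact absurd h3 (Real.sin_pos_of_pos_of_lt_pi (by linarith) (by linarith)).ne'
  · right
    have : (α + A) / 2 = Real.pi / 2 := by
      apply Real.injOn_cos ⟨by linarith, by linarith⟩ ⟨by linarith, by linarith⟩
      rw [h3, Real.cos_pi_div_two]
    linarith

section Equality

variable {m : ℕ} {ξ : Fin m → ℂ} {M : ℝ} {Q : Set ℂ} {α : ℝ}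

theorem eventually_zerosEnvelope_mul_eq (hξ : ∀ j, ‖ξ j‖ = 1)
    (hQ : IsClosed Q) (hQs : Q ⊆ unitCircle)
    (h0 : 0 < α) (hπ : α < Real.pi) (hm : volume (angleSet Q) = ENNReal.ofReal (2 * α))
    (hPM : ∀ z ∈ Q, ‖zerosProd ξ z‖ ≤ M) (hm1 : 1 ≤ m) (hM : M = 2 * Real.sin (α / 2) ^ m)
    {z : ℂ} (hz : z ∉ Q) (h1 : ‖z‖ = 1) :
    ∀ᶠ w in 𝓝 z, zerosEnvelope ξ M w * ‖herglotzDisc Q α w‖ ^ m = M := by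
  have hM0 : 0 ≤ M := by rw [hM]; have := sin_half_pos h0 hπ; positivity
  have hdiff : ∀ z ∈ Qᶜ, DifferentiableAt ℂ (herglotzDisc Q α) z :=
    fun z hz => differentiableAt_herglotzDisc hQ h0 hπ hz
  -- The radius from `0`, where the maximum is attained, to `z` meets the unit circle only at `z`,
  -- hence avoids `Q`.
  refine eq_of_hasHolomorphicSupport hQ (C := M) (A := segment ℝ 0 z) (z₀ := 0)
    (f := fun w => zerosEnvelope ξ M w * ‖herglotzDisc Q α w‖ ^ m) ?_ ?_ ?_
    (convex_segment _ _).isPreconnected ?_ (left_mem_segment _ _ _) ?_ z (right_mem_segment _ _ _)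
  · have : ContinuousOn (herglotzDisc Q α) Qᶜ :=
      fun z hz => (hdiff z hz).continuousAt.continuousWithinAt
    exact (continuous_zerosEnvelope ξ M).continuousOn.mul (this.norm.pow _)
  · intro z hz
    simp only [← norm_pow]
    refine (hasHolomorphicSupportAt_zerosEnvelope ξ M z).mul_norm ?_
    filter_upwards [hQ.isOpen_compl.mem_nhds hz] with w hw using (hdiff w hw).pow _
  · intro w hw
    exact zerosEnvelope_mul_le M hξ hQ hQs h0 hπ hm hM0 hPM hm1 hw
  · intro w hw hwQ
    rw [segment_eq_image] at hw
    obtain ⟨r, hr, rfl⟩ := hw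
    have hn : ‖(1 - r) • (0 : ℂ) + r • z‖ = 1 := by simpa [unitCircle] using hQs hwQ
    rw [smul_zero, zero_add, norm_smul, h1, mul_one, Real.norm_of_nonneg hr.1] at hn
    rw [hn] at hwQ
    simp at hwQ
    exact hz hwQ
  · rw [zerosEnvelope_zero M hξ hm1, norm_herglotzDisc_zero h0 hπ hm, hM]

theorem lt_norm_zerosProd (hξ : ∀ j, ‖ξ j‖ = 1) (hQ : IsClosed Q)
    (h0 : 0 < α) (hπ : α < Real.pi) (hm1 : 1 ≤ m) (hM0 : 0 < M)
    {z : ℂ} (hz : z ∉ Q) (h1 : ‖z‖ = 1)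
    (heq : zerosEnvelope ξ M z * ‖herglotzDisc Q α z‖ ^ m = M) : M < ‖zerosProd ξ z‖ := by
  by_contra! hle
  rw [zerosEnvelope_eq_of_le M hξ hM0.le h1 hle] at heq
  have h2 := (herglotzDisc_of_norm_eq_one hQ h0 hπ hz h1).2.1
  have h3 : ‖herglotzDisc Q α z‖ ^ m < 1 := pow_lt_one₀ (norm_nonneg _) h2 (by omega)
  nlinarith

/-- Equality forces `‖P‖ > M` on the circle off `Q`, so `Y / P²` is positive there and its principal
root `R` is holomorphic nearby. Then `h = P(1 + R)B^m` is holomorphic with `‖h‖ ≤ M`, attained at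
`z`, hence locally constant. On the circle `h²` has phase `P(0) w^m e^{2im arg B}`. -/
theorem eventually_exp_phase_eq (hξ : ∀ j, ‖ξ j‖ = 1)
    (hQ : IsClosed Q) (h0 : 0 < α) (hπ : α < Real.pi) (hm1 : 1 ≤ m) (hM0 : 0 < M)
    {z : ℂ} (hz : z ∉ Q) (h1 : ‖z‖ = 1)
    (heq : ∀ᶠ w in 𝓝 z, zerosEnvelope ξ M w * ‖herglotzDisc Q α w‖ ^ m = M) :
    ∀ᶠ w in 𝓝 z, ‖w‖ = 1 →
      w ^ m * Complex.exp ((Complex.arg (herglotzDisc Q α w) : ℂ) * Complex.I) ^ (2 * m) =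
      z ^ m * Complex.exp ((Complex.arg (herglotzDisc Q α z) : ℂ) * Complex.I) ^ (2 * m) := by
  set B := herglotzDisc Q α with hB
  set P := zerosProd ξ with hP
  set Y := zerosDisc ξ M with hY
  have hratio : ∀ w, ‖w‖ = 1 → w ∉ Q → zerosEnvelope ξ M w * ‖B w‖ ^ m = M →
      P w ≠ 0 ∧ 0 < 1 - M ^ 2 / ‖P w‖ ^ 2 ∧ Y w / P w ^ 2 = ((1 - M ^ 2 / ‖P w‖ ^ 2 : ℝ) : ℂ) := by
    intro w hw hwQ hwe
    have hlt := lt_norm_zerosProd hξ hQ h0 hπ hm1 hM0 hwQ hw hwe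
    have hP0 : 0 < ‖P w‖ := hM0.trans hlt
    refine ⟨norm_pos_iff.1 hP0, ?_, ?_⟩
    · rw [sub_pos, div_lt_one (by positivity)]
      gcongr
    · rw [hY, zerosDisc_of_norm_eq_one M hξ hw, zerosProd_sq hξ hw, mul_div_mul_left,
        ← Complex.ofReal_div, sub_div, div_self (by positivity)]
      rw [← norm_pos_iff, norm_mul, norm_zerosProd_zero hξ, norm_pow, hw]
      simp
  have hPd : Differentiable ℂ P := differentiable_zerosProd ξ
  have hYd : Differentiable ℂ Y := differentiable_zerosDisc ξ M
  obtain ⟨hPz, hrz, hYz⟩ := hratio z h1 hz heq.self_of_nhds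
  set R : ℂ → ℂ := fun w => (Y w / P w ^ 2) ^ (1 / 2 : ℂ) with hR
  set h : ℂ → ℂ := fun w => P w * (1 + R w) * B w ^ m with hh
  have hPne : ∀ᶠ w in 𝓝 z, P w ≠ 0 := hPd.continuous.continuousAt.eventually_ne hPz
  have hnhdsQ : ∀ᶠ w in 𝓝 z, w ∉ Q := hQ.isOpen_compl.mem_nhds hz
  have hslit : ∀ᶠ w in 𝓝 z, Y w / P w ^ 2 ∈ Complex.slitPlane := by
    have hcont : ContinuousAt (fun w => Y w / P w ^ 2) z :=
      (hYd z).continuousAt.div ((hPd z).continuousAt.pow 2) (pow_ne_zero 2 hPz)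
    refine hcont.eventually_mem (Complex.isOpen_slitPlane.mem_nhds ?_)
    rw [hYz]
    exact Complex.ofReal_mem_slitPlane.2 hrz
  have hd : ∀ᶠ w in 𝓝 z, DifferentiableAt ℂ h w := by
    filter_upwards [hPne, hslit, hnhdsQ] with w h2 h3 h4
    have h5 : DifferentiableAt ℂ R w :=
      ((hYd w).div ((hPd w).pow 2) (pow_ne_zero 2 h2)).cpow_const h3
    exact ((hPd w).mul (h5.const_add 1)).mul ((differentiableAt_herglotzDisc hQ h0 hπ h4).pow m)
  have henv : ∀ w, P w ≠ 0 → zerosEnvelope ξ M w = max ‖P w + P w * R w‖ ‖P w - P w * R w‖ := by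
    intro w hw
    have h2 : (P w * R w) ^ 2 = Y w := by
      rw [mul_pow, hR, ← Complex.cpow_nat_mul]
      norm_num
      field_simp
    rw [← rootEnvelope_sq_eq_max, h2]
    rfl
  have hRreal : ∀ w, ‖w‖ = 1 → w ∉ Q → zerosEnvelope ξ M w * ‖B w‖ ^ m = M →
      ∃ r : ℝ, 0 < r ∧ R w = r := by
    intro w hw hwQ hwe
    obtain ⟨-, hpos, hval⟩ := hratio w hw hwQ hwe
    refine ⟨(1 - M ^ 2 / ‖P w‖ ^ 2) ^ (1 / 2 : ℝ), Real.rpow_pos_of_pos hpos _, ?_⟩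
    rw [hR, Complex.ofReal_cpow hpos.le]
    simp only [hval]
    norm_num
  have hle : ∀ᶠ w in 𝓝 z, ‖h w‖ ≤ M := by
    filter_upwards [hPne, heq] with w h2 h3
    rw [← h3, henv w h2, hh]
    simp only [norm_mul, norm_pow, mul_add, mul_one]
    gcongr
    exact le_max_left _ _
  have hzM : ‖h z‖ = M := by
    obtain ⟨r, hr, hRr⟩ := hRreal z h1 hz heq.self_of_nhds
    conv_rhs => rw [← heq.self_of_nhds, henv z hPz]
    have h2 : ‖P z - P z * R z‖ ≤ ‖P z + P z * R z‖ := by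
      rw [show P z - P z * R z = P z * (1 - R z) by ring,
        show P z + P z * R z = P z * (1 + R z) by ring, norm_mul, norm_mul, hRr]
      gcongr
      norm_cast
      rw [Real.norm_eq_abs, Real.norm_eq_abs, abs_of_pos (by linarith : 0 < 1 + r)]
      exact abs_le.2 ⟨by linarith, by linarith⟩
    rw [max_eq_left h2, hh]
    simp only [norm_mul, norm_pow]
    rw [← norm_mul, mul_add, mul_one]
  have hconst : ∀ᶠ w in 𝓝 z, h w = h z := by
    refine Complex.eventually_eq_of_isLocalMax_norm hd ?_
    filter_upwards [hle] with w hw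
    simp only [Function.comp, hzM]
    exact hw
  have hform : ∀ w, ‖w‖ = 1 → w ∉ Q → zerosEnvelope ξ M w * ‖B w‖ ^ m = M →
      h w ^ 2 = (‖h w‖ ^ 2 : ℝ) * (P 0 * (w ^ m *
        Complex.exp ((Complex.arg (B w) : ℂ) * Complex.I) ^ (2 * m))) := by
    intro w hw hwQ hwe
    obtain ⟨r, hr, hRr⟩ := hRreal w hw hwQ hwe
    have hBw := Complex.norm_mul_exp_arg_mul_I (B w)
    have hnorm : ‖h w‖ = ‖P w‖ * (1 + r) * ‖B w‖ ^ m := by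
      rw [hh]
      simp only [norm_mul, norm_pow, hRr]
      norm_cast
      rw [Real.norm_of_nonneg (by linarith : 0 ≤ 1 + r)]
    rw [hnorm, hh]
    simp only [hRr]
    conv_lhs => rw [← hBw]
    rw [mul_pow, mul_pow, hP, zerosProd_sq hξ hw]
    push_cast
    ring
  have hP0 : P 0 ≠ 0 := by
    rw [← norm_pos_iff, hP, norm_zerosProd_zero hξ]; exact one_pos
  filter_upwards [hconst, heq, hnhdsQ] with w h2 h3 h4 hw
  have e1 := hform w hw h4 h3
  rw [h2, hform z h1 hz heq.self_of_nhds, hzM] at e1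
  have hM2 : ((M ^ 2 : ℝ) : ℂ) ≠ 0 := by exact_mod_cast (pow_pos hM0 2).ne'
  exact (mul_left_cancel₀ hP0 (mul_left_cancel₀ hM2 e1)).symm

end Equality

section Gap

variable {m : ℕ} {ξ : Fin m → ℂ} {M : ℝ} {Q : Set ℂ} {α : ℝ}

theorem eventually_phase_eq (hξ : ∀ j, ‖ξ j‖ = 1)
    (hQ : IsClosed Q) (h0 : 0 < α) (hπ : α < Real.pi) (hm1 : 1 ≤ m) (hM0 : 0 < M)
    {θ : ℝ} (hθ : Complex.exp (θ * Complex.I) ∉ Q)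
    (heq : ∀ᶠ w in 𝓝 (Complex.exp (θ * Complex.I)),
      zerosEnvelope ξ M w * ‖herglotzDisc Q α w‖ ^ m = M) :
    ∀ᶠ t : ℝ in 𝓝 θ, t + 2 * Complex.arg (herglotzDisc Q α (Complex.exp (t * Complex.I))) =
      θ + 2 * Complex.arg (herglotzDisc Q α (Complex.exp (θ * Complex.I))) := by
  have h1 : ∀ t : ℝ, ‖Complex.exp (t * Complex.I)‖ = 1 := Complex.norm_exp_ofReal_mul_I
  have hcont : Continuous fun t : ℝ => Complex.exp (t * Complex.I) := by fun_prop
  set κ : ℝ → ℝ := fun t =>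
    t + 2 * Complex.arg (herglotzDisc Q α (Complex.exp (t * Complex.I))) with hκ
  have hκc : ContinuousAt κ θ := by
    have hB : ContinuousAt (fun t : ℝ => herglotzDisc Q α (Complex.exp (t * Complex.I))) θ :=
      (differentiableAt_herglotzDisc hQ h0 hπ hθ).continuousAt.comp_of_eq hcont.continuousAt rfl
    have hslit : herglotzDisc Q α (Complex.exp (θ * Complex.I)) ∈ Complex.slitPlane :=
      Complex.mem_slitPlane_iff.2 (Or.inr (herglotzDisc_of_norm_eq_one hQ h0 hπ hθ (h1 θ)).1.ne')
    exact continuousAt_id.add (((Complex.continuousAt_arg hslit).comp_of_eq hB rfl).const_mul 2)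
  -- Equality of the exponentials fixes `κ` only modulo `2π/m`; continuity of `κ` excludes a nonzero
  -- jump. Continuity of `arg` rests on `Im B > 0`.
  have hclose : ∀ᶠ t in 𝓝 θ, |κ t - κ θ| < 2 * Real.pi / m := by
    have hm0 : (0 : ℝ) < m := by exact_mod_cast hm1
    have := hκc.eventually (Metric.ball_mem_nhds (κ θ) (ε := 2 * Real.pi / m)
      (div_pos Real.two_pi_pos hm0))
    filter_upwards [this] with t ht
    rwa [Real.dist_eq] at ht
  have hexp := hcont.continuousAt.eventually
    (eventually_exp_phase_eq hξ hQ h0 hπ hm1 hM0 hθ (h1 θ) heq)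
  have hphase : ∀ t : ℝ, Complex.exp (t * Complex.I) ^ m * Complex.exp ((Complex.arg
      (herglotzDisc Q α (Complex.exp (t * Complex.I))) : ℂ) * Complex.I) ^ (2 * m) =
      Complex.exp (((m * κ t : ℝ) : ℂ) * Complex.I) := by
    intro t
    rw [← Complex.exp_nat_mul, ← Complex.exp_nat_mul, ← Complex.exp_add, hκ]
    congr 1
    push_cast
    ring
  filter_upwards [hclose, hexp] with t ht he
  have he := he (h1 t)
  rw [hphase, hphase, Complex.exp_eq_exp_iff_exists_int] at he
  obtain ⟨n, hn⟩ := he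
  have hm0 : (0 : ℝ) < m := by exact_mod_cast hm1
  have hn' : m * κ t = m * κ θ + n * (2 * Real.pi) := by
    have h2 : ((m * κ t : ℝ) : ℂ) = ((m * κ θ + n * (2 * Real.pi) : ℝ) : ℂ) := by
      apply mul_right_cancel₀ Complex.I_ne_zero
      rw [hn]
      push_cast
      ring
    exact_mod_cast h2
  have hn0 : n = 0 := by
    have h3 : m * (κ t - κ θ) = n * (2 * Real.pi) := by linarith
    have h4 : (m : ℝ) * |κ t - κ θ| < 2 * Real.pi := by
      rw [lt_div_iff₀ hm0] at ht
      linarith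
    rw [← abs_of_pos hm0, ← abs_mul, h3, abs_mul, abs_of_pos Real.two_pi_pos] at h4
    have h5 : |(n : ℝ)| < 1 := by nlinarith [Real.two_pi_pos]
    exact Int.abs_lt_one_iff.1 (by exact_mod_cast h5)
  rw [hn0] at hn'
  simp only [Int.cast_zero, zero_mul, add_zero] at hn'
  exact mul_left_cancel₀ hm0.ne' hn'

theorem exists_phase_eq (hξ : ∀ j, ‖ξ j‖ = 1)
    (hQ : IsClosed Q) (hQs : Q ⊆ unitCircle)
    (h0 : 0 < α) (hπ : α < Real.pi) (hm : volume (angleSet Q) = ENNReal.ofReal (2 * α))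
    (hPM : ∀ z ∈ Q, ‖zerosProd ξ z‖ ≤ M) (hm1 : 1 ≤ m) (hM : M = 2 * Real.sin (α / 2) ^ m)
    {a b : ℝ} (hgap : ∀ t ∈ Set.Ioo a b, Complex.exp (t * Complex.I) ∉ Q) :
    ∃ K : ℝ, ∀ t ∈ Set.Ioo a b,
      t + 2 * Complex.arg (herglotzDisc Q α (Complex.exp (t * Complex.I))) = K := by
  have hM0 : 0 < M := by rw [hM]; have := sin_half_pos h0 hπ; positivity
  have hder : ∀ t ∈ Set.Ioo a b, HasDerivAt
      (fun t : ℝ => t + 2 * Complex.arg (herglotzDisc Q α (Complex.exp (t * Complex.I)))) 0 t := by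
    intro t ht
    refine (hasDerivAt_const t _).congr_of_eventuallyEq (eventually_phase_eq hξ hQ h0 hπ hm1 hM0
      (hgap t ht) (eventually_zerosEnvelope_mul_eq hξ hQ hQs h0 hπ hm hPM hm1 hM (hgap t ht)
      (Complex.norm_exp_ofReal_mul_I t)))
  exact isOpen_Ioo.exists_is_const_of_deriv_eq_zero isPreconnected_Ioo
    (fun t ht => (hder t ht).differentiableAt.differentiableWithinAt)
    (fun t ht => (hder t ht).deriv)

/-- At an endpoint in `Q` the envelope tends to `M`, so `‖B‖ → 1`, while `arg B` tends to `A = (K -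
e)/2`. The circle equation for `B` becomes `sin(α/2 + A) = sin(α/2)` in the limit, leaving `A = 0`
or `A = π - α`. -/
theorem phase_endpoint (hξ : ∀ j, ‖ξ j‖ = 1)
    (hQ : IsClosed Q) (hQs : Q ⊆ unitCircle)
    (h0 : 0 < α) (hπ : α < Real.pi) (hm : volume (angleSet Q) = ENNReal.ofReal (2 * α))
    (hPM : ∀ z ∈ Q, ‖zerosProd ξ z‖ ≤ M) (hm1 : 1 ≤ m) (hM : M = 2 * Real.sin (α / 2) ^ m)
    {a b K e : ℝ} (hgap : ∀ t ∈ Set.Ioo a b, Complex.exp (t * Complex.I) ∉ Q)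
    (hK : ∀ t ∈ Set.Ioo a b,
      t + 2 * Complex.arg (herglotzDisc Q α (Complex.exp (t * Complex.I))) = K)
    (he : e ∈ closure (Set.Ioo a b)) (heQ : Complex.exp (e * Complex.I) ∈ Q) :
    e = K ∨ e = K - 2 * (Real.pi - α) := by
  have hM0 : 0 < M := by rw [hM]; have := sin_half_pos h0 hπ; positivity
  have h1 : ∀ t : ℝ, ‖Complex.exp (t * Complex.I)‖ = 1 := Complex.norm_exp_ofReal_mul_I
  have hcont : Continuous fun t : ℝ => Complex.exp (t * Complex.I) := by fun_prop
  set B : ℝ → ℂ := fun t => herglotzDisc Q α (Complex.exp (t * Complex.I)) with hB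
  set l := 𝓝[Set.Ioo a b] e with hl
  have : l.NeBot := mem_closure_iff_nhdsWithin_neBot.1 he
  have hmem : ∀ᶠ t in l, t ∈ Set.Ioo a b := self_mem_nhdsWithin
  have hid : Tendsto (fun t : ℝ => t) l (𝓝 e) := tendsto_id.mono_left nhdsWithin_le_nhds
  have henv : Tendsto (fun t : ℝ => zerosEnvelope ξ M (Complex.exp (t * Complex.I))) l (𝓝 M) := by
    have h2 : zerosEnvelope ξ M (Complex.exp (e * Complex.I)) = M :=
      zerosEnvelope_eq_of_le M hξ hM0.le (h1 e) (hPM _ heQ)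
    have h3 := ((continuous_zerosEnvelope ξ M).comp hcont).tendsto e
    simp only [Function.comp, h2] at h3
    exact h3.mono_left nhdsWithin_le_nhds
  have hpow : Tendsto (fun t => ‖B t‖ ^ m) l (𝓝 1) := by
    have h2 := (tendsto_const_nhds (x := M)).div henv hM0.ne'
    rw [div_self hM0.ne'] at h2
    refine h2.congr' ?_
    filter_upwards [hmem] with t ht
    have h3 := (eventually_zerosEnvelope_mul_eq hξ hQ hQs h0 hπ hm hPM hm1 hM (hgap t ht)
      (h1 t)).self_of_nhds
    have h4 : zerosEnvelope ξ M (Complex.exp (t * Complex.I)) ≠ 0 := by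
      intro h5; rw [h5, zero_mul] at h3; exact hM0.ne h3
    simp only [Pi.div_apply]
    rw [div_eq_iff h4, mul_comm]
    exact h3.symm
  have hnorm : Tendsto (fun t => ‖B t‖) l (𝓝 1) := by
    have h2 := hpow.rpow_const (p := (m : ℝ)⁻¹) (Or.inl one_ne_zero)
    rw [Real.one_rpow] at h2
    refine h2.congr fun t => ?_
    exact Real.pow_rpow_inv_natCast (norm_nonneg _) (by omega)
  have harg : Tendsto (fun t => Complex.arg (B t)) l (𝓝 ((K - e) / 2)) := by
    refine ((hid.const_sub K).div_const 2).congr' ?_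
    filter_upwards [hmem] with t ht
    rw [← hK t ht]
    ring
  set A := (K - e) / 2 with hA
  have hA0 : 0 ≤ A := by
    refine ge_of_tendsto harg ?_
    filter_upwards [hmem] with t ht
    exact Complex.arg_nonneg_iff.2 (herglotzDisc_of_norm_eq_one hQ h0 hπ (hgap t ht) (h1 t)).1.le
  have hAπ : A ≤ Real.pi :=
    le_of_tendsto harg (Eventually.of_forall fun t => Complex.arg_le_pi _)
  have hsin : Real.sin (α / 2 + A) = Real.sin (α / 2) := by
    have hleft : Tendsto (fun t => ‖B t‖ * Real.sin (α / 2 + Complex.arg (B t))) l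
        (𝓝 (1 * Real.sin (α / 2 + A))) :=
      hnorm.mul ((Real.continuous_sin.tendsto _).comp (harg.const_add _))
    have hright : Tendsto (fun t => Real.sin (α / 2) * ((1 + ‖B t‖ ^ 2) / 2)) l
        (𝓝 (Real.sin (α / 2) * ((1 + 1 ^ 2) / 2))) :=
      (((hnorm.pow 2).const_add 1).div_const 2).const_mul _
    have h2 : ∀ᶠ t in l, Real.sin (α / 2) * ((1 + ‖B t‖ ^ 2) / 2) =
        ‖B t‖ * Real.sin (α / 2 + Complex.arg (B t)) := by
      filter_upwards [hmem] with t ht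
      rw [← (herglotzDisc_of_norm_eq_one hQ h0 hπ (hgap t ht) (h1 t)).2.2]
      change (_ * B t).im = _
      conv_lhs => rw [← Complex.norm_mul_exp_arg_mul_I (B t)]
      rw [mul_left_comm, ← Complex.exp_add, ← add_mul, ← Complex.ofReal_add,
        Complex.im_ofReal_mul, Complex.exp_ofReal_mul_I_im]
    have h3 := tendsto_nhds_unique (hright.congr' h2) hleft
    norm_num at h3
    exact h3.symm
  rcases eq_zero_or_of_sin_add_eq h0 hπ hA0 hAπ hsin with h2 | h2
  · left; linarith
  · right; linarith

theorem gap_length (hξ : ∀ j, ‖ξ j‖ = 1)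
    (hQ : IsClosed Q) (hQs : Q ⊆ unitCircle)
    (h0 : 0 < α) (hπ : α < Real.pi) (hm : volume (angleSet Q) = ENNReal.ofReal (2 * α))
    (hPM : ∀ z ∈ Q, ‖zerosProd ξ z‖ ≤ M) (hm1 : 1 ≤ m) (hM : M = 2 * Real.sin (α / 2) ^ m)
    {a b : ℝ} (hab : a < b) (hgap : ∀ t ∈ Set.Ioo a b, Complex.exp (t * Complex.I) ∉ Q)
    (ha : Complex.exp (a * Complex.I) ∈ Q) (hb : Complex.exp (b * Complex.I) ∈ Q) :
    b - a = 2 * (Real.pi - α) := by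
  obtain ⟨K, hK⟩ := exists_phase_eq hξ hQ hQs h0 hπ hm hPM hm1 hM hgap
  have hcl : closure (Set.Ioo a b) = Set.Icc a b := closure_Ioo hab.ne
  have e1 := phase_endpoint hξ hQ hQs h0 hπ hm hPM hm1 hM hgap hK
    (hcl ▸ Set.left_mem_Icc.2 hab.le) ha
  have e2 := phase_endpoint hξ hQ hQs h0 hπ hm hPM hm1 hM hgap hK
    (hcl ▸ Set.right_mem_Icc.2 hab.le) hb
  -- Both endpoints lie in the same two-point set, and `a < b` rules out every other combination.
  rcases e1 with e1 | e1 <;> rcases e2 with e2 | e2 <;> linarith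

end Gap

/-! ### From a single gap to an arc. -/

theorem exp_add_two_pi_mul_I (t : ℝ) :
    Complex.exp (((t + 2 * Real.pi : ℝ) : ℂ) * Complex.I) = Complex.exp (t * Complex.I) := by
  push_cast
  rw [add_mul, Complex.exp_add, Complex.exp_two_pi_mul_I, mul_one]

theorem volume_angleSet_eq {Q : Set ℂ} (hQ : IsClosed Q) (c : ℝ) :
    volume (angleSet Q) =
      volume ({t : ℝ | Complex.exp (t * Complex.I) ∈ Q} ∩ Set.Ioc c (c + 2 * Real.pi)) := by
  have hper : ∀ g : AddSubgroup.zmultiples (2 * Real.pi),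
      (g +ᵥ ·) ⁻¹' {t : ℝ | Complex.exp (t * Complex.I) ∈ Q} =
        {t : ℝ | Complex.exp (t * Complex.I) ∈ Q} := by
    rintro ⟨g, hg⟩
    obtain ⟨n, rfl⟩ := AddSubgroup.mem_zmultiples_iff.1 hg
    ext t
    simp only [Set.mem_preimage, Set.mem_ofPred_eq, AddSubgroup.mk_vadd, vadd_eq_add]
    have : Complex.exp (((n • (2 * Real.pi) + t : ℝ) : ℂ) * Complex.I) =
        Complex.exp (t * Complex.I) := by
      rw [Complex.exp_eq_exp_iff_exists_int]
      exact ⟨n, by push_cast [zsmul_eq_mul]; ring⟩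
    rw [this]
  have h := (isAddFundamentalDomain_Ioc Real.two_pi_pos 0 volume).measure_set_eq
    (isAddFundamentalDomain_Ioc Real.two_pi_pos c volume)
    (isClosed_preimage_exp hQ).measurableSet hper
  rw [← h, zero_add]
  have : angleSet Q = {t : ℝ | Complex.exp (t * Complex.I) ∈ Q} ∩ Set.Ico 0 (2 * Real.pi) :=
    Set.inter_comm _ _
  rw [this]
  exact measure_congr ((ae_eq_refl _).inter Ico_ae_eq_Ioc)

/-- Since `0 < 2α < 2π`, both `Q` and its complement are nonempty on the circle; the gap around a
missing angle `c` ends at the nearest angles of `Q` on either side, which exist by periodicity. -/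
theorem exists_gap {Q : Set ℂ} (hQ : IsClosed Q) {α : ℝ} (h0 : 0 < α) (hπ : α < Real.pi)
    (hm : volume (angleSet Q) = ENNReal.ofReal (2 * α)) :
    ∃ a b : ℝ, a < b ∧ (∀ t ∈ Set.Ioo a b, Complex.exp (t * Complex.I) ∉ Q) ∧
      Complex.exp (a * Complex.I) ∈ Q ∧ Complex.exp (b * Complex.I) ∈ Q := by
  set Z : Set ℝ := {t : ℝ | Complex.exp (t * Complex.I) ∈ Q} with hZ
  have hZc : IsClosed Z := isClosed_preimage_exp hQ
  obtain ⟨c, hc⟩ : ∃ c, c ∉ Z := by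
    by_contra! hall
    have h1 := volume_angleSet_eq hQ 0
    rw [show {t : ℝ | Complex.exp (t * Complex.I) ∈ Q} = Set.univ from
      Set.eq_univ_of_forall hall, Set.univ_inter, Real.volume_Ioc, hm,
      ENNReal.ofReal_eq_ofReal_iff (by linarith) (by linarith)] at h1
    linarith
  obtain ⟨d, hdZ, hd⟩ : (Z ∩ Set.Ioc c (c + 2 * Real.pi)).Nonempty := by
    by_contra! hne
    have h1 := volume_angleSet_eq hQ c
    rw [hne, measure_empty, hm, ENNReal.ofReal_eq_zero] at h1
    linarith
  have hd' : d - 2 * Real.pi ∈ Z := by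
    have := exp_add_two_pi_mul_I (d - 2 * Real.pi)
    rw [sub_add_cancel] at this
    rw [hZ, Set.mem_ofPred_eq, ← this]
    exact hdZ
  have hright : sInf (Z ∩ Set.Ici c) ∈ Z ∩ Set.Ici c :=
    (hZc.inter isClosed_Ici).csInf_mem ⟨d, hdZ, hd.1.le⟩ ⟨c, fun x hx => hx.2⟩
  have hleft : sSup (Z ∩ Set.Iic c) ∈ Z ∩ Set.Iic c :=
    (hZc.inter isClosed_Iic).csSup_mem ⟨d - 2 * Real.pi, hd', by
      have := hd.2; simp only [Set.mem_Iic]; linarith⟩ ⟨c, fun x hx => hx.2⟩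
  refine ⟨sSup (Z ∩ Set.Iic c), sInf (Z ∩ Set.Ici c), ?_, ?_, hleft.1, hright.1⟩
  · refine lt_of_le_of_ne (hleft.2.trans hright.2) fun heq => hc ?_
    have : c = sSup (Z ∩ Set.Iic c) := le_antisymm (heq ▸ hright.2) hleft.2
    rw [this]; exact hleft.1
  · intro t ht htZ
    rcases le_total t c with h | h
    · exact absurd (le_csSup (s := Z ∩ Set.Iic c) ⟨c, fun x hx => hx.2⟩ ⟨htZ, h⟩) (not_le.2 ht.1)
    · exact absurd (csInf_le (s := Z ∩ Set.Ici c) ⟨c, fun x hx => hx.2⟩ ⟨htZ, h⟩) (not_le.2 ht.2)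

theorem eq_circleArc_of_gap {Q : Set ℂ} (hQ : IsClosed Q) (hQs : Q ⊆ unitCircle) {α : ℝ}
    (hm : volume (angleSet Q) = ENNReal.ofReal (2 * α)) {a b : ℝ}
    (hab : b - a = 2 * (Real.pi - α))
    (hgap : ∀ t ∈ Set.Ioo a b, Complex.exp (t * Complex.I) ∉ Q)
    (ha : Complex.exp (a * Complex.I) ∈ Q) (hb : Complex.exp (b * Complex.I) ∈ Q) :
    Q = circleArc b (a + 2 * Real.pi) := by
  set Z : Set ℝ := {t : ℝ | Complex.exp (t * Complex.I) ∈ Q} with hZ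
  have hZc : IsClosed Z := isClosed_preimage_exp hQ
  have hsub : Z ∩ Set.Ioc a (a + 2 * Real.pi) ⊆ Set.Icc b (a + 2 * Real.pi) := by
    rintro t ⟨htZ, ht⟩
    refine ⟨?_, ht.2⟩
    by_contra! hlt
    exact hgap t ⟨ht.1, hlt⟩ htZ
  have hvol := volume_angleSet_eq hQ a
  rw [hm] at hvol
  apply Set.Subset.antisymm
  · intro q hq
    have hq1 : ‖q‖ = 1 := by simpa [unitCircle] using hQs hq
    obtain ⟨t, ht, hqt⟩ : ∃ t ∈ Set.Ioc a (a + 2 * Real.pi), q = Complex.exp (t * Complex.I) := by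
      refine ⟨toIocMod Real.two_pi_pos a (Complex.arg q), toIocMod_mem_Ioc _ _ _, ?_⟩
      have h1 : q = Complex.exp (Complex.arg q * Complex.I) := by
        have := Complex.norm_mul_exp_arg_mul_I q
        rw [hq1] at this
        simpa using this.symm
      conv_lhs => rw [h1]
      rw [Complex.exp_eq_exp_iff_exists_int]
      refine ⟨toIocDiv Real.two_pi_pos a (Complex.arg q), ?_⟩
      conv_lhs => rw [← toIocMod_add_toIocDiv_zsmul Real.two_pi_pos a (Complex.arg q)]
      push_cast [zsmul_eq_mul]
      ring
    exact ⟨t, hsub ⟨by rw [hZ, Set.mem_ofPred_eq, ← hqt]; exact hq, ht⟩, hqt.symm⟩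
  · rintro _ ⟨t, ht, rfl⟩
    by_contra htQ
    have htZ : t ∉ Z := htQ
    have hb' : b < t := lt_of_le_of_ne ht.1 fun h => htZ (h ▸ hb)
    have ha' : t < a + 2 * Real.pi := lt_of_le_of_ne ht.2 fun h => htZ (by
      rw [h, hZ, Set.mem_ofPred_eq, exp_add_two_pi_mul_I]; exact ha)
    -- The complementary closed arc has length exactly `2α`. A point of it missing from `Q` would
    -- bring a missing open set of positive measure, leaving too little for `Q`.
    have hopen : IsOpen (Set.Ioo b (a + 2 * Real.pi) ∩ Zᶜ) := isOpen_Ioo.inter hZc.isOpen_compl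
    have hpos : 0 < volume (Set.Ioo b (a + 2 * Real.pi) ∩ Zᶜ) :=
      hopen.measure_pos volume ⟨t, ⟨hb', ha'⟩, htZ⟩
    have hle : volume (Z ∩ Set.Ioc a (a + 2 * Real.pi)) + volume (Set.Ioo b (a + 2 * Real.pi) ∩ Zᶜ)
        ≤ volume (Set.Icc b (a + 2 * Real.pi)) := by
      rw [← measure_union _ hopen.measurableSet]
      · exact measure_mono (Set.union_subset hsub fun x hx => Set.Ioo_subset_Icc_self hx.1)
      · exact Set.disjoint_left.2 fun x hx hx' => hx'.2 hx.1
    rw [← hvol, Real.volume_Icc, show a + 2 * Real.pi - b = 2 * α by linarith] at hle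
    exact absurd hle (not_le.2 (ENNReal.lt_add_right ENNReal.ofReal_ne_top hpos.ne'))

theorem exists_eq_circleArc {m : ℕ} {ξ : Fin m → ℂ} {M : ℝ} {Q : Set ℂ} {α : ℝ}
    (hξ : ∀ j, ‖ξ j‖ = 1)
    (hQ : IsClosed Q) (hQs : Q ⊆ unitCircle)
    (h0 : 0 < α) (hπ : α < Real.pi) (hm : volume (angleSet Q) = ENNReal.ofReal (2 * α))
    (hPM : ∀ z ∈ Q, ‖zerosProd ξ z‖ ≤ M) (hm1 : 1 ≤ m) (hM : M = 2 * Real.sin (α / 2) ^ m) :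
    ∃ a b : ℝ, b - a = 2 * α ∧ Q = circleArc a b := by
  obtain ⟨a, b, hab, hgap, ha, hb⟩ := exists_gap hQ h0 hπ hm
  have hlen := gap_length hξ hQ hQs h0 hπ hm hPM hm1 hM hab hgap ha hb
  exact ⟨b, a + 2 * Real.pi, by linarith, eq_circleArc_of_gap hQ hQs hm hlen hgap ha hb⟩

/-! ### The extremal polynomial of an arc. -/

theorem eval_T_eq_prod (m : ℕ) (x : ℝ) :
    (Polynomial.Chebyshev.T ℝ m).eval x =
      2 ^ (m - 1) * ∏ j : Fin m, (x - Real.cos ((2 * (j : ℕ) + 1) * Real.pi / (2 * m))) := by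
  have hroots : (Polynomial.Chebyshev.T ℝ m).roots = Multiset.map
      (fun k : ℕ => Real.cos ((2 * k + 1) * Real.pi / (2 * m))) (Multiset.range m) := by
    rw [Polynomial.Chebyshev.roots_T_real, Finset.image_val_of_injOn]
    · rfl
    · exact (Finset.range m).nodup_map_iff_injOn.mp (Polynomial.Chebyshev.roots_T_real_nodup m)
  have hcard : Multiset.card (Polynomial.Chebyshev.T ℝ m).roots =
      (Polynomial.Chebyshev.T ℝ m).natDegree := by
    rw [hroots, Polynomial.Chebyshev.natDegree_T]
    simp
  have h := Polynomial.C_leadingCoeff_mul_prod_multiset_X_sub_C hcard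
  conv_lhs => rw [← h]
  rw [Polynomial.Chebyshev.leadingCoeff_T, Polynomial.eval_mul, Polynomial.eval_C,
    Polynomial.eval_multiset_prod, hroots, Multiset.map_map, Multiset.map_map, Int.natAbs_natCast,
    Fin.prod_univ_eq_prod_range (fun k => x - Real.cos ((2 * (k : ℕ) + 1) * Real.pi / (2 * m)))]
  congr 1
  simp only [Function.comp_def, Polynomial.eval_sub, Polynomial.eval_X, Polynomial.eval_C]
  rfl

theorem norm_exp_sub_exp (s t : ℝ) :
    ‖Complex.exp (t * Complex.I) - Complex.exp (s * Complex.I)‖ =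
      |2 * Real.sin ((t - s) / 2)| := by
  rw [← Real.norm_eq_abs, ← Complex.norm_exp_I_mul_ofReal_sub_one]
  have : Complex.exp (t * Complex.I) - Complex.exp (s * Complex.I) =
      Complex.exp (s * Complex.I) * (Complex.exp (Complex.I * ((t - s : ℝ) : ℂ)) - 1) := by
    rw [mul_sub, ← Complex.exp_add, mul_one]
    congr 2
    push_cast
    ring
  rw [this, norm_mul, Complex.norm_exp_ofReal_mul_I, one_mul]

/-- Pairing `φ` with `-φ` and using `sin(u - φ) sin(u + φ) = sin² u - sin² φ`. Comparing squares of
the products also covers an unpaired middle index. -/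
theorem prod_abs_sin_sub_eq {m : ℕ} (φ : Fin m → ℝ) (hφ : ∀ j, φ j.rev = -φ j) (u : ℝ) :
    ∏ j, |2 * Real.sin (u - φ j)| = ∏ j, |2 * (Real.sin u - Real.sin (φ j))| := by
  have hX : ∏ j, |2 * Real.sin (u - φ j)| = ∏ j, |2 * Real.sin (u + φ j)| := by
    rw [← Equiv.prod_comp Fin.revPerm]
    simp [hφ]
  have hY : ∏ j, |2 * (Real.sin u - Real.sin (φ j))| = ∏ j, |2 * (Real.sin u + Real.sin (φ j))| := by
    rw [← Equiv.prod_comp Fin.revPerm]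
    simp [hφ]
  rw [← sq_eq_sq₀ (Finset.prod_nonneg fun _ _ => abs_nonneg _)
    (Finset.prod_nonneg fun _ _ => abs_nonneg _), sq, sq]
  conv_lhs => rw [hX]; arg 1; rw [← hX]
  conv_rhs => rw [hY]; arg 1; rw [← hY]
  rw [← Finset.prod_mul_distrib, ← Finset.prod_mul_distrib]
  refine Finset.prod_congr rfl fun j _ => ?_
  rw [← abs_mul, ← abs_mul, Real.sin_sub, Real.sin_add]
  congr 1
  linear_combination 4 * (Real.sin u ^ 2) * Real.sin_sq_add_cos_sq (φ j) -
    4 * (Real.sin (φ j) ^ 2) * Real.sin_sq_add_cos_sq u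

/-- The arguments, relative to the midpoint of an arc of length `2α`, of the zeros of the extremal
polynomial of the arc. -/
noncomputable def extremalAngle (m : ℕ) (α : ℝ) (j : Fin m) : ℝ :=
  Real.arcsin (Real.sin (α / 2) * Real.cos ((2 * (j : ℕ) + 1) * Real.pi / (2 * m)))

theorem extremalAngle_rev {m : ℕ} (α : ℝ) (j : Fin m) :
    extremalAngle m α j.rev = -extremalAngle m α j := by
  have hm : (m : ℝ) ≠ 0 := by exact_mod_cast (Fin.pos j).ne'
  unfold extremalAngle
  rw [← Real.arcsin_neg, ← mul_neg, ← Real.cos_pi_sub, Fin.val_rev, Nat.cast_sub (by omega)]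
  congr 3
  push_cast
  field_simp
  ring

theorem abs_extremalAngle_le {m : ℕ} {α : ℝ} (h0 : 0 < α) (hπ : α < Real.pi) (j : Fin m) :
    |extremalAngle m α j| ≤ α / 2 := by
  have hs := sin_half_pos h0 hπ
  have harc : Real.arcsin (Real.sin (α / 2)) = α / 2 :=
    Real.arcsin_sin (by linarith) (by linarith)
  rw [abs_le]
  constructor
  · rw [← harc, ← Real.arcsin_neg]
    exact Real.monotone_arcsin (by
      nlinarith [Real.neg_one_le_cos ((2 * (j : ℕ) + 1) * Real.pi / (2 * m))])
  · conv_rhs => rw [← harc]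
    exact Real.monotone_arcsin (by
      nlinarith [Real.cos_le_one ((2 * (j : ℕ) + 1) * Real.pi / (2 * m))])

theorem sin_extremalAngle {m : ℕ} {α : ℝ} (h0 : 0 < α) (hπ : α < Real.pi) (j : Fin m) :
    Real.sin (extremalAngle m α j) =
      Real.sin (α / 2) * Real.cos ((2 * (j : ℕ) + 1) * Real.pi / (2 * m)) := by
  have hs := sin_half_pos h0 hπ
  have h1 := Real.sin_le_one (α / 2)
  exact Real.sin_arcsin
    (by nlinarith [Real.neg_one_le_cos ((2 * (j : ℕ) + 1) * Real.pi / (2 * m))])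
    (by nlinarith [Real.cos_le_one ((2 * (j : ℕ) + 1) * Real.pi / (2 * m))])

/-- The zeros of the extremal polynomial of the arc with midpoint `c` and length `2α`. -/
noncomputable def extremalZero (m : ℕ) (α c : ℝ) (j : Fin m) : ℂ :=
  Complex.exp (((c + 2 * extremalAngle m α j : ℝ) : ℂ) * Complex.I)

/-- With `u = (t - c)/2` and `x = sin u / sin(α/2)`, the modulus equals `(2 sin(α/2))^m ∏ |x - cos
θ_j|`, where the `cos θ_j` are the zeros of `T_m`. This is `2 sin(α/2)^m |T_m(x)|` with `|x| ≤ 1`.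
-/
theorem norm_zerosProd_extremalZero_le {m : ℕ} (hm : 1 ≤ m) {α : ℝ} (h0 : 0 < α)
    (hπ : α < Real.pi) {c t : ℝ} (ht : |t - c| ≤ α) :
    ‖zerosProd (extremalZero m α c) (Complex.exp (t * Complex.I))‖ ≤
      2 * Real.sin (α / 2) ^ m := by
  have hs := sin_half_pos h0 hπ
  set u := (t - c) / 2 with hu
  have hu' : |u| ≤ α / 2 := by
    rw [hu, abs_div, abs_two]; linarith
  have hsu : |Real.sin u| ≤ Real.sin (α / 2) := by
    rw [abs_le] at hu' ⊢
    rw [← Real.sin_neg]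
    exact ⟨Real.sin_le_sin_of_le_of_le_pi_div_two (by linarith) (by linarith) hu'.1,
      Real.sin_le_sin_of_le_of_le_pi_div_two (by linarith) (by linarith) hu'.2⟩
  have h1 : ‖zerosProd (extremalZero m α c) (Complex.exp (t * Complex.I))‖ =
      ∏ j : Fin m, |2 * Real.sin (u - extremalAngle m α j)| := by
    unfold zerosProd extremalZero
    rw [norm_prod]
    refine Finset.prod_congr rfl fun j _ => ?_
    rw [norm_exp_sub_exp]
    congr 3
    rw [hu]; ring
  rw [h1, prod_abs_sin_sub_eq _ (extremalAngle_rev α)]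
  set x := Real.sin u / Real.sin (α / 2) with hx
  have hx1 : |x| ≤ 1 := by
    rw [hx, abs_div, abs_of_pos hs, div_le_one hs]; exact hsu
  have h2 : ∀ j : Fin m, |2 * (Real.sin u - Real.sin (extremalAngle m α j))| =
      2 * Real.sin (α / 2) * |x - Real.cos ((2 * (j : ℕ) + 1) * Real.pi / (2 * m))| := by
    intro j
    rw [sin_extremalAngle h0 hπ]
    have : Real.sin u = Real.sin (α / 2) * x := by rw [hx]; field_simp
    rw [this, ← mul_sub, ← mul_assoc, abs_mul, abs_of_pos (by positivity)]
  have hT := Polynomial.Chebyshev.abs_eval_T_real_le_one m hx1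
  rw [eval_T_eq_prod, abs_mul, abs_of_pos (by positivity), Finset.abs_prod] at hT
  rw [Finset.prod_congr rfl fun j _ => h2 j, Finset.prod_mul_distrib, Finset.prod_const,
    Finset.card_univ, Fintype.card_fin, mul_pow]
  obtain ⟨k, rfl⟩ : ∃ k, m = k + 1 := ⟨m - 1, by omega⟩
  rw [Nat.add_sub_cancel] at hT
  calc _ = 2 * Real.sin (α / 2) ^ (k + 1) * (2 ^ k * ∏ j : Fin (k + 1),
        |x - Real.cos ((2 * (j : ℕ) + 1) * Real.pi / (2 * ((k + 1 : ℕ) : ℝ)))|) := by ring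
    _ ≤ 2 * Real.sin (α / 2) ^ (k + 1) * 1 := by gcongr
    _ = _ := mul_one _

/-! ### Arcs, infima over polynomials, and the final assembly. -/

theorem isCompact_circleArc (a b : ℝ) : IsCompact (circleArc a b) :=
  isCompact_Icc.image (by fun_prop)

theorem circleArc_subset_unitCircle (a b : ℝ) : circleArc a b ⊆ unitCircle := by
  rintro _ ⟨t, -, rfl⟩
  simp [unitCircle, Complex.norm_exp_ofReal_mul_I]

theorem circleArc_mem_compactsOfMeasure {α : ℝ} (hπ : α < Real.pi) {a b : ℝ}
    (hab : b - a = 2 * α) : circleArc a b ∈ compactsOfMeasure (2 * α) := by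
  refine ⟨isCompact_circleArc a b, circleArc_subset_unitCircle a b, ?_⟩
  change volume (angleSet (circleArc a b)) = _
  -- The period `(b - 2π, b]` contains all of `[a, b]`, because `α < π`.
  rw [volume_angleSet_eq (isCompact_circleArc a b).isClosed (b - 2 * Real.pi), sub_add_cancel,
    ← hab, ← Real.volume_Icc]
  congr 1
  ext t
  constructor
  · rintro ⟨⟨s, hs, hst⟩, ht⟩
    obtain ⟨n, hn⟩ := Complex.exp_eq_exp_iff_exists_int.1 hst
    have hn' : s = t + n * (2 * Real.pi) := by
      have : ((s : ℝ) : ℂ) = ((t + n * (2 * Real.pi) : ℝ) : ℂ) := by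
        apply mul_right_cancel₀ Complex.I_ne_zero
        rw [hn]; push_cast; ring
      exact_mod_cast this
    have hpi := Real.pi_pos
    have h1 : n < 1 := by
      have : (n : ℝ) < 1 := by nlinarith [ht.1, hs.2]
      exact_mod_cast this
    have h2 : -1 < n := by
      have : (-1 : ℝ) < n := by nlinarith [ht.2, hs.1]
      exact_mod_cast this
    have h3 : n = 0 := by omega
    rw [h3, Int.cast_zero, zero_mul, add_zero] at hn'
    exact hn' ▸ hs
  · intro ht
    exact ⟨⟨t, ht, rfl⟩, by linarith [ht.1], ht.2⟩

theorem eval_prod_X_sub_C {m : ℕ} (ξ : Fin m → ℂ) (z : ℂ) :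
    (∏ j, (Polynomial.X - Polynomial.C (ξ j))).eval z = zerosProd ξ z := by
  simp [Polynomial.eval_prod, zerosProd]

theorem norm_eval_le_polySupNorm {Q : Set ℂ} (hQ : IsCompact Q) (P : Polynomial ℂ) {z : ℂ}
    (hz : z ∈ Q) : ‖P.eval z‖ ≤ polySupNorm Q P :=
  le_csSup (hQ.bddAbove_image P.continuous.norm.continuousOn) ⟨z, hz, rfl⟩

theorem polySupNorm_nonneg (Q : Set ℂ) (P : Polynomial ℂ) : 0 ≤ polySupNorm Q P :=
  Real.sSup_nonneg (by rintro _ ⟨z, -, rfl⟩; exact norm_nonneg _)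

theorem bddBelow_polySupNorm (Q : Set ℂ) (S : Set (Polynomial ℂ)) :
    BddBelow (polySupNorm Q '' S) :=
  ⟨0, by rintro _ ⟨P, -, rfl⟩; exact polySupNorm_nonneg Q P⟩

theorem polysWithZerosOn_nonempty (m : ℕ) {S : Set ℂ} (hS : S.Nonempty) :
    (polysWithZerosOn m S).Nonempty :=
  hS.imp' (fun s => ∏ _j : Fin m, (Polynomial.X - Polynomial.C s))
    fun s hs => ⟨fun _ => s, fun _ => hs, rfl⟩

theorem unitCircle_nonempty : unitCircle.Nonempty := ⟨1, by simp [unitCircle]⟩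

theorem le_polySupNorm {m : ℕ} (hm : 1 ≤ m) {α : ℝ} (h0 : 0 < α) (hπ : α < Real.pi) {Q : Set ℂ}
    (hQ : Q ∈ compactsOfMeasure (2 * α)) {P : Polynomial ℂ}
    (hP : P ∈ polysWithZerosOn m unitCircle) : 2 * Real.sin (α / 2) ^ m ≤ polySupNorm Q P := by
  obtain ⟨ξ, hξ, rfl⟩ := hP
  obtain ⟨hQc, hQs, hQm⟩ := hQ
  refine two_mul_sin_pow_le (ξ := ξ) _ (fun j => by simpa [unitCircle] using hξ j) hQc.isClosed hQs
    h0 hπ hQm (polySupNorm_nonneg _ _) (fun z hz => ?_) hm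
  rw [← eval_prod_X_sub_C]
  exact norm_eval_le_polySupNorm hQc _ hz

theorem le_leastDeviation {m : ℕ} (hm : 1 ≤ m) {α : ℝ} (h0 : 0 < α) (hπ : α < Real.pi) {Q : Set ℂ}
    (hQ : Q ∈ compactsOfMeasure (2 * α)) : 2 * Real.sin (α / 2) ^ m ≤ leastDeviation m Q := by
  refine le_csInf ((polysWithZerosOn_nonempty m unitCircle_nonempty).image _) ?_
  rintro _ ⟨P, hP, rfl⟩
  exact le_polySupNorm hm h0 hπ hQ hP

/-- The equality analysis needs an actual polynomial: zeros of a minimizing sequence converge along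
a subsequence, by compactness of the product of circles. -/
theorem exists_zeros_le_leastDeviation (m : ℕ) {Q : Set ℂ} (hQ : IsCompact Q) :
    ∃ ξ : Fin m → ℂ, (∀ j, ξ j ∈ unitCircle) ∧
      ∀ z ∈ Q, ‖zerosProd ξ z‖ ≤ leastDeviation m Q := by
  obtain ⟨u, -, hu, hmem⟩ := exists_seq_tendsto_sInf
    ((polysWithZerosOn_nonempty m unitCircle_nonempty).image (polySupNorm Q))
    (bddBelow_polySupNorm Q _)
  choose P hP hPu using hmem
  choose ξ hξ hPξ using hP
  have hcomp : IsCompact (Set.univ.pi fun _ : Fin m => unitCircle) :=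
    isCompact_univ_pi fun _ => isCompact_sphere 0 1
  obtain ⟨η, hη, φ, hφ, hlim⟩ := hcomp.tendsto_subseq (x := ξ) fun n j _ => hξ n j
  refine ⟨η, fun j => hη j trivial, fun z hz => ?_⟩
  have hcont : Continuous fun ξ : Fin m → ℂ => ‖zerosProd ξ z‖ := by
    unfold zerosProd; fun_prop
  refine le_of_tendsto_of_tendsto' ((hcont.tendsto η).comp hlim) (hu.comp hφ.tendsto_atTop)
    fun n => ?_
  simp only [Function.comp]
  rw [← hPu, ← eval_prod_X_sub_C, ← hPξ]
  exact norm_eval_le_polySupNorm hQ _ hz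

theorem exists_extremal_poly_circleArc {m : ℕ} (hm : 1 ≤ m) {α : ℝ} (h0 : 0 < α)
    (hπ : α < Real.pi) {a b : ℝ} (hab : b - a = 2 * α) :
    ∃ P ∈ polysWithZerosOn m (circleArc a b),
      polySupNorm (circleArc a b) P ≤ 2 * Real.sin (α / 2) ^ m := by
  refine ⟨_, ⟨extremalZero m α ((a + b) / 2), fun j => ?_, rfl⟩, ?_⟩
  · have := abs_le.1 (abs_extremalAngle_le h0 hπ j)
    exact ⟨_, ⟨by linarith, by linarith⟩, rfl⟩
  · have hne : (circleArc a b).Nonempty := ⟨_, a, ⟨le_rfl, by linarith⟩, rfl⟩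
    refine csSup_le (hne.image _) ?_
    rintro _ ⟨_, ⟨t, ht, rfl⟩, rfl⟩
    simp only [eval_prod_X_sub_C]
    exact norm_zerosProd_extremalZero_le hm h0 hπ
      (abs_le.2 ⟨by linarith [ht.1], by linarith [ht.2]⟩)

theorem polysWithZerosOn_mono (m : ℕ) {S T : Set ℂ} (h : S ⊆ T) :
    polysWithZerosOn m S ⊆ polysWithZerosOn m T := by
  rintro P ⟨ξ, hξ, rfl⟩
  exact ⟨ξ, fun j => h (hξ j), rfl⟩

theorem leastDeviation_circleArc {m : ℕ} (hm : 1 ≤ m) {α : ℝ} (h0 : 0 < α)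
    (hπ : α < Real.pi) {a b : ℝ} (hab : b - a = 2 * α) :
    leastDeviation m (circleArc a b) = 2 * Real.sin (α / 2) ^ m := by
  refine le_antisymm ?_ (le_leastDeviation hm h0 hπ (circleArc_mem_compactsOfMeasure hπ hab))
  obtain ⟨P, hP, hle⟩ := exists_extremal_poly_circleArc hm h0 hπ hab
  exact (csInf_le (bddBelow_polySupNorm _ _)
    ⟨P, polysWithZerosOn_mono m (circleArc_subset_unitCircle a b) hP, rfl⟩).trans hle

theorem theorem7 (m : ℕ) (hm : 1 ≤ m) (α : ℝ) (hα0 : 0 < α) (hαπ : α < Real.pi) :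
    (∀ Q ∈ compactsOfMeasure (2 * α),
      2 * Real.sin (α / 2) ^ m ≤ leastDeviation m Q ∧
      (leastDeviation m Q = 2 * Real.sin (α / 2) ^ m ↔
        ∃ a b : ℝ, b - a = 2 * α ∧ Q = circleArc a b)) ∧
    leastDeviationOfMeasure m (2 * α) = 2 * Real.sin (α / 2) ^ m ∧
    (∀ a b : ℝ, b - a = 2 * α →
      arcDeviation m a b = 2 * Real.sin (α / 2) ^ m ∧
      ∃ P ∈ polysWithZerosOn m (circleArc a b),
        polySupNorm (circleArc a b) P = arcDeviation m a b) := by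
  refine ⟨fun Q hQ => ⟨le_leastDeviation hm hα0 hαπ hQ, fun heq => ?_, ?_⟩, ?_, ?_⟩
  · obtain ⟨ξ, hξ, hle⟩ := exists_zeros_le_leastDeviation m hQ.1
    exact exists_eq_circleArc (fun j => by simpa [unitCircle] using hξ j) hQ.1.isClosed hQ.2.1
      hα0 hαπ hQ.2.2 hle hm heq
  · rintro ⟨a, b, hab, rfl⟩
    exact leastDeviation_circleArc hm hα0 hαπ hab
  · have hab : 2 * α - 0 = 2 * α := sub_zero _
    have harc := circleArc_mem_compactsOfMeasure hαπ hab
    have hlow : ∀ x ∈ leastDeviation m '' compactsOfMeasure (2 * α),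
        2 * Real.sin (α / 2) ^ m ≤ x := by
      rintro _ ⟨Q, hQ, rfl⟩
      exact le_leastDeviation hm hα0 hαπ hQ
    refine le_antisymm ?_ (le_csInf ⟨_, _, harc, rfl⟩ hlow)
    rw [← leastDeviation_circleArc hm hα0 hαπ hab]
    exact csInf_le ⟨_, hlow⟩ ⟨_, harc, rfl⟩
  · intro a b hab
    have harc := circleArc_mem_compactsOfMeasure hαπ hab
    obtain ⟨P, hP, hle⟩ := exists_extremal_poly_circleArc hm hα0 hαπ hab
    have hlow : ∀ P ∈ polysWithZerosOn m (circleArc a b),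
        2 * Real.sin (α / 2) ^ m ≤ polySupNorm (circleArc a b) P := fun P hP =>
      le_polySupNorm hm hα0 hαπ harc
        (polysWithZerosOn_mono m (circleArc_subset_unitCircle a b) hP)
    have hdev : arcDeviation m a b = 2 * Real.sin (α / 2) ^ m := by
      refine le_antisymm ((csInf_le (bddBelow_polySupNorm _ _) ⟨P, hP, rfl⟩).trans hle)
        (le_csInf ⟨_, P, hP, rfl⟩ ?_)
      rintro _ ⟨P, hP, rfl⟩
      exact hlow P hP
    exact ⟨hdev, P, hP, hdev ▸ le_antisymm hle (hlow P hP)⟩
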